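/- Consider a junction with one incoming link $I_1=[a_1,b_1]$ and $n\ge 2$ outgoing links $I_i=[a_i,b_i]$, $i=2,\dots,n+1$, where $I_1$ meets the junction at $b_1$ and $I_i$ at $a_i$; the far ends $a_1$ and $b_i$ ($i\ge2$) may be finite or infinite. Link $I_i$ has a triangular fundamental diagram $f_i(\rho)=\min\{k_i\rho,\;w_i(\rho_i^{jam}-\rho)\}$ on $[0,\rho_i^{jam}]$, with $k_i,w_i,\rho_i^{jam}>0$ and capacity $C_i=\max f_i=k_iw_i\rho_i^{jam}/(k_i+w_i)$. A pair $(q,r)\in[0,C_i]\times\{0,1\}$ denotes the density $\psi_i(q,0)=q/k_i$ (free flow) or $\psi_i(q,1)=\rho_i^{jam}-q/w_i$ (congestion); the two pairs $(C_i,0)$ and $(C_i,1)$ denote the same density. Let turning ratios $\alpha_{1,i}\ge0$ with $\sum_{i=2}^{n+1}\alpha_{1,i}=1$ be given. For initial states $y_{i,0}=(q_{i,0},r_{i,0})\in[0,C_i]\times\{0,1\}$ and boundary states $\hat y_i=(\hat q_i,\hat r_i)\in[0,C_i]\times\{0,1\}$, $i=1,\dots,n+1$, consider the initial-boundary value problems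 $$\partial_t\rho_i+\partial_xf_i(\rho_i)=0\ \text{ on } I_i,\qquad \rho_i(0,x)=\psi_i(y_{i,0}),\qquad \rho_1(t,b_1-)=\psi_1(\hat y_1),\quad \rho_i(t,a_i+)=\psi_i(\hat y_i)\ (i\ge2).$$ A solution is a family of Kruzhkov entropy solutions $\rho_i:[0,\infty)\times I_i\to[0,\rho_i^{jam}]$, continuous in time with values in $L^1_{loc}$, that attain the boundary values as one-sided limits for a.e. $t>0$. Nothing is prescribed at the far ends. Call a family $(\rho_i)$ a distributed solution if every $\rho_i(t,\cdot)$ has bounded variation and (i) it is a weak solution at the junction, i.e. $\sum_{i=1}^{n+1}\iint(\rho_i\,\partial_t\varphi_i+f_i(\rho_i)\,\partial_x\varphi_i)\,dx\,dt=0$ for all smooth $\varphi_i$ with compact support in $(0,\infty)\times(a_1,b_1]$ for $i=1$ and in $(0,\infty)\times[a_i,b_i)$ for $i\ge2$ such that $\varphi_1(\cdot,b_1)=\varphi_i(\cdot,a_i)$ and $\partial_x\varphi_1(\cdot,b_1)=\partial_x\varphi_i(\cdot,a_i)$ for $i\ge2$; and (ii) $f_i(\rho_i(t,a_i+))=\alpha_{1,i}\,f_1(\rho_1(t,b_1-))$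 for $i\ge2$ and a.e. $t>0$. It is an admissible weak solution for the given initial states (in the sense of Coclite, Garavello and Piccoli) if moreover (iii) $f_1(\rho_1(t,b_1-))$ is, for a.e. $t$, maximal among all distributed solutions that solve the initial-boundary value problems with the same initial states and some tuple of boundary states. **Theorem.** For all initial states $y_{i,0}\in[0,C_i]\times\{0,1\}$ there are boundary states $\hat y_i\in[0,C_i]\times\{0,1\}$, $i=1,\dots,n+1$, such that the initial-boundary value problems have a solution that is an admissible weak solution. This solution is unique almost everywhere where waves from the far ends cannot have arrived, i.e. where $x-k_1t>a_1$ on $I_1$ and $x+w_it<b_i$ on $I_i$, $i\ge2$ (everywhere, if the far ends are infinite). The boundary states are unique, up to the identification of $(C_i,0)$ with $(C_i,1)$. One may take them as follows: $$\hat q_1=\min\Big\{q_1^{max},\ \frac{q_2^{max}}{\alpha_{1,2}},\dots,\frac{q_{n+1}^{max}}{\alpha_{1,n+1}}\Big\},\qquad \hat q_i=\alpha_{1,i}\,\hat q_1\quad(i\ge2),$$ where the terms with $\alpha_{1,i}=0$ are omitted from the minimum, $$\hat r_1=\begin{cases}1,& r_{1,0}=1\\ 0,& r_{1,0}=0,\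 \hat q_1=q_{1,0}\\ 1,& r_{1,0}=0,\ \hat q_1<q_{1,0}\end{cases}\qquad \hat r_i=\begin{cases}0,& r_{i,0}=0\\ 1,& r_{i,0}=1,\ \hat q_i=q_{i,0}\\ 0,& r_{i,0}=1,\ \hat q_i<q_{i,0}\end{cases}\quad(i\ge2),$$ $$q_1^{max}=q_{1,0}+r_{1,0}(C_1-q_{1,0}),\qquad q_i^{max}=C_i+r_{i,0}(q_{i,0}-C_i)\quad(i\ge2).$$ -/

import Mathlib

open MeasureTheory Set Filter Topology
open scoped ContDiff

namespace TrafficJunction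

/-- The parameters of a triangular fundamental diagram: speed of forward waves `vf`, (absolute)
speed of backward waves `w`, and jam density `rhoJam`. -/
structure Diagram where
  vf : ℝ
  w : ℝ
  rhoJam : ℝ
  vf_pos : 0 < vf
  w_pos : 0 < w
  rhoJam_pos : 0 < rhoJam

namespace Diagram

/-- The critical density, where the two branches of the triangle meet. -/
noncomputable def crit (F : Diagram) : ℝ := F.w * F.rhoJam / (F.vf + F.w)

/-- The flow capacity `C`, the height of the triangle. -/
noncomputable def capacity (F : Diagram) : ℝ := F.vf * F.w * F.rhoJam / (F.vf + F.w)

/-- The triangular density-flow relation `f` on `[0, rhoJam]`: the increasing branch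
`vf * r` up to the critical density, the decreasing branch `w * (rhoJam - r)` after it. -/
noncomputable def flux (F : Diagram) (r : ℝ) : ℝ := min (F.vf * r) (F.w * (F.rhoJam - r))

end Diagram

/-- A (flow, regime) pair; regime `0` is free flow and regime `1` is congestion. -/
abbrev State : Type := ℝ × Fin 2

/-- The pair lies in `[0, C] × {0, 1}`. -/
def IsState (F : Diagram) (y : State) : Prop := y.1 ∈ Icc 0 F.capacity

/-- The map `ψ` from (flow, regime) pairs to densities. -/
noncomputable def density (F : Diagram) (y : State) : ℝ :=
  if y.2 = 0 then y.1 / F.vf else F.rhoJam - y.1 / F.w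

/-- `density` picks a density with the given flow, on the branch given by the regime. -/
theorem density_spec (F : Diagram) (y : State) (hy : IsState F y) :
    F.flux (density F y) = y.1 ∧
      (y.2 = 0 → density F y ∈ Icc 0 F.crit) ∧
      (y.2 = 1 → density F y ∈ Icc F.crit F.rhoJam) := by
  obtain ⟨q, r⟩ := y
  obtain ⟨h0, h1⟩ := hy
  have hk := F.vf_pos
  have hw := F.w_pos
  have hkw : 0 < F.vf + F.w := by positivity
  simp only [Diagram.capacity, le_div_iff₀ hkw] at h0 h1
  have e1 : F.vf * (q / F.vf) = q := by field_simp
  have e2 : F.w * (q / F.w) = q := by field_simp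
  have p1 : 0 ≤ q / F.vf := by positivity
  have p2 : 0 ≤ q / F.w := by positivity
  have c1 : q / F.vf ≤ F.crit := by
    rw [Diagram.crit, div_le_div_iff₀ hk hkw]; nlinarith
  have c2 : F.crit ≤ F.rhoJam - q / F.w := by
    have : F.rhoJam - q / F.w = (F.w * F.rhoJam - q) / F.w := by field_simp
    rw [this, Diagram.crit, div_le_div_iff₀ hkw hw]; nlinarith
  have b1 : F.crit * (F.vf + F.w) = F.w * F.rhoJam := by
    rw [Diagram.crit]; field_simp
  fin_cases r
  · refine ⟨?_, fun _ => ?_, fun h => ?_⟩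
    · simp only [density, Diagram.flux]
      simp only [Fin.zero_eta, if_true]
      rw [min_eq_left, e1]
      nlinarith
    · simpa [density] using And.intro p1 c1
    · simp at h
  · refine ⟨?_, fun h => ?_, fun _ => ?_⟩
    · simp only [density, Diagram.flux, Fin.mk_one, one_ne_zero, if_false]
      rw [min_eq_right, sub_sub_cancel, e2]
      nlinarith
    · simp at h
    · simpa [density] using And.intro c2 p2

/-- Entropy solutions `r t x` of `∂ₜ r + ∂ₓ f(r) = 0` on `[0, ∞) × I`, for an open interval `I`,
with constant initial value `r0`: densities in `[0, rhoJam]`, continuous in time with values in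
`L¹_loc(I)`, with the weak formulation and Kruzhkov's entropy inequalities in the interior.
Points of `ℝ × ℝ` are pairs (time, position). -/
structure IsEntropySolution (F : Diagram) (I : Set ℝ) (r0 : ℝ) (r : ℝ → ℝ → ℝ) : Prop where
  mem_range : ∀ t, 0 ≤ t → ∀ x ∈ I, r t x ∈ Icc 0 F.rhoJam
  measurable : AEStronglyMeasurable (Function.uncurry r) (volume.restrict (Ioi 0 ×ˢ I))
  measurable_slice : ∀ t, 0 ≤ t → AEStronglyMeasurable (r t) (volume.restrict I)
  continuous : ∀ t₀, 0 ≤ t₀ → ∀ K, IsCompact K → K ⊆ I →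
    Tendsto (fun t => ∫ x in K, |r t x - r t₀ x|) (𝓝[Ici 0] t₀) (𝓝 0)
  initial : ∀ᵐ x ∂(volume.restrict I), r 0 x = r0
  weak : ∀ φ : ℝ × ℝ → ℝ, ContDiff ℝ ∞ φ → HasCompactSupport φ → tsupport φ ⊆ Ioi 0 ×ˢ I →
    ∫ p in Ioi 0 ×ˢ I, (r p.1 p.2 * fderiv ℝ φ p (1, 0)
      + F.flux (r p.1 p.2) * fderiv ℝ φ p (0, 1)) = 0
  entropy : ∀ k ∈ Icc 0 F.rhoJam, ∀ φ : ℝ × ℝ → ℝ, ContDiff ℝ ∞ φ → HasCompactSupport φ →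
    tsupport φ ⊆ Ioi 0 ×ˢ I → (∀ p, 0 ≤ φ p) →
    0 ≤ ∫ p in Ioi 0 ×ˢ I, (|r p.1 p.2 - k| * fderiv ℝ φ p (1, 0)
      + Real.sign (r p.1 p.2 - k) * (F.flux (r p.1 p.2) - F.flux k) * fderiv ℝ φ p (0, 1))

/-- A junction with one incoming link (index `0`) and `n` outgoing links (indices `i.succ`).
`node l` is the end of link `l` at the junction, `far l` its other end, possibly infinite; so the
incoming link is `[far 0, node 0]` and the outgoing ones are `[node l, far l]`.
`α i` is the fraction of the traffic that turns into the outgoing link `i.succ`. -/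
structure Junction (n : ℕ) where
  diag : Fin (n + 1) → Diagram
  node : Fin (n + 1) → ℝ
  far : Fin (n + 1) → EReal
  far_lt : far 0 < node 0
  lt_far : ∀ i : Fin n, node i.succ < far i.succ
  α : Fin n → ℝ
  α_nonneg : ∀ i, 0 ≤ α i
  α_sum : ∑ i, α i = 1

namespace Junction

variable {n : ℕ}

/-- The open interval of link `l`. -/
def link (J : Junction n) (l : Fin (n + 1)) : Set ℝ :=
  if l = 0 then {x | J.far l < x ∧ x < J.node l} else {x | J.node l < x ∧ (x : EReal) < J.far l}

/-- The points on the junction's side of the far end of link `l`, also beyond the junction. -/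
def nearSide (J : Junction n) (l : Fin (n + 1)) : Set ℝ :=
  if l = 0 then {x | J.far l < x} else {x | (x : EReal) < J.far l}

/-- The filter of points of link `l` that approach the junction. -/
def side (J : Junction n) (l : Fin (n + 1)) : Filter ℝ :=
  if l = 0 then 𝓝[<] (J.node l) else 𝓝[>] (J.node l)

/-- The (time, position) pairs of link `l` that no wave from its far end can have reached.
This is the whole of `(0, ∞) × link l` if the far end is infinite. -/
def determined (J : Junction n) (l : Fin (n + 1)) : Set (ℝ × ℝ) :=
  {p | 0 < p.1 ∧ p.2 ∈ J.link l ∧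
    if l = 0 then J.far l < ((p.2 - (J.diag l).vf * p.1 : ℝ) : EReal)
    else ((p.2 + (J.diag l).w * p.1 : ℝ) : EReal) < J.far l}

/-- The flow `f(r(t, ±))` at the junction end of link `l`, from the one-sided limit of the density
inside the link (which exists for densities of bounded variation). -/
noncomputable def flow (J : Junction n) (l : Fin (n + 1)) (r : ℝ → ℝ → ℝ) (t : ℝ) : ℝ :=
  (J.diag l).flux (limUnder (J.side l) (r t))

/-- On every link, `ρ l` solves the initial-boundary value problem with initial state `y₀ l` and
boundary state `y l` at the junction; the boundary value is attained as a one-sided limit. -/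
structure SolvesIBVP (J : Junction n) (y₀ y : Fin (n + 1) → State)
    (ρ : Fin (n + 1) → ℝ → ℝ → ℝ) : Prop where
  entropySolution : ∀ l,
    IsEntropySolution (J.diag l) (J.link l) (density (J.diag l) (y₀ l)) (ρ l)
  boundary : ∀ l, ∀ᵐ t ∂(volume.restrict (Ioi 0)),
    Tendsto (ρ l t) (J.side l) (𝓝 (density (J.diag l) (y l)))

/-- `ρ` is a weak solution at the junction: the weak formulations of the links add up to zero for
test functions that are smooth across the junction. -/
def IsWeakSolutionAt (J : Junction n) (ρ : Fin (n + 1) → ℝ → ℝ → ℝ) : Prop :=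
  ∀ φ : Fin (n + 1) → ℝ × ℝ → ℝ,
    (∀ l, ContDiff ℝ ∞ (φ l) ∧ HasCompactSupport (φ l) ∧
      tsupport (φ l) ⊆ Ioi 0 ×ˢ J.nearSide l) →
    (∀ (i : Fin n) (t : ℝ),
      φ 0 (t, J.node 0) = φ i.succ (t, J.node i.succ) ∧
      fderiv ℝ (φ 0) (t, J.node 0) (0, 1) = fderiv ℝ (φ i.succ) (t, J.node i.succ) (0, 1)) →
    ∑ l, ∫ p in Ioi 0 ×ˢ J.link l, (ρ l p.1 p.2 * fderiv ℝ (φ l) p (1, 0)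
      + (J.diag l).flux (ρ l p.1 p.2) * fderiv ℝ (φ l) p (0, 1)) = 0

/-- The densities have bounded variation at every time, form a weak solution at the junction, and
distribute the traffic according to the turning ratios. -/
structure IsDistributedSolution (J : Junction n) (ρ : Fin (n + 1) → ℝ → ℝ → ℝ) : Prop where
  boundedVariation : ∀ l t, 0 ≤ t → BoundedVariationOn (ρ l t) (J.link l)
  weakSolution : J.IsWeakSolutionAt ρ
  distribution : ∀ i : Fin n, ∀ᵐ t ∂(volume.restrict (Ioi 0)),
    J.flow i.succ (ρ i.succ) t = J.α i * J.flow 0 (ρ 0) t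

/-- The admissible weak solutions of the Riemann problem at the junction with initial states `y₀`:
distributed solutions for which the flow through the junction is maximal among all distributed
solutions that start from `y₀` and solve the initial-boundary value problems for some tuple of
boundary states. -/
structure IsAdmissible (J : Junction n) (y₀ : Fin (n + 1) → State)
    (ρ : Fin (n + 1) → ℝ → ℝ → ℝ) : Prop where
  distributed : J.IsDistributedSolution ρ
  maximal : ∀ (z : Fin (n + 1) → State) (ρ' : Fin (n + 1) → ℝ → ℝ → ℝ),
    (∀ l, IsState (J.diag l) (z l)) → J.SolvesIBVP y₀ z ρ' → J.IsDistributedSolution ρ' →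
    ∀ᵐ t ∂(volume.restrict (Ioi 0)), J.flow 0 (ρ' 0) t ≤ J.flow 0 (ρ 0) t

/-- The demand of the incoming link and the supply of the outgoing links. -/
noncomputable def qmax (J : Junction n) (y₀ : Fin (n + 1) → State) (l : Fin (n + 1)) : ℝ :=
  if l = 0 then (y₀ l).1 + ((y₀ l).2 : ℕ) * ((J.diag l).capacity - (y₀ l).1)
  else (J.diag l).capacity + ((y₀ l).2 : ℕ) * ((y₀ l).1 - (J.diag l).capacity)

end Junction

end TrafficJunction

open TrafficJunction

/-!
The states at the junction are found link by link, and only flows are exchanged between the links.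

*Comparison on a link.* An outgoing link becomes an incoming one if the space is reflected and the
vehicles are exchanged with the spaces between them (`IsEntropySolution.reflect`), so let the
junction be at the right end `b`. Since the boundary value `z` is attained as a one-sided limit, the
entropy inequality for a pair `(U, G)` extends to test functions that do not vanish at `b`, if
`G z ≥ 0` (`EntropyIneq.up_to_boundary`). With a test function that decreases in time, it
shows that `U` vanishes in every region that no entropy enters (`EntropyIneq.eq_zero`). As the
solution is only compared with constants, no doubling of variables is needed.

*Admissible boundary values.* Comparison with the initial density and with the critical density
shows that only those values `z` are attained that can be connected to the initial density `r0` by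
waves of negative speed (`IsEntropySolution.isAdmissibleTrace`). For the triangular flux such a
Riemann problem is solved by a single wave, of speed `s < 0`
(`IsAdmissibleTrace.exists_isWaveSpeed`). The density stays between `r0` and `z`, where the flux
lies on one side of the chord, and comparison with `r0` to the left and with `z` to the right of
the line `x = b + s * t` shows that the wave is the only solution
(`IsEntropySolution.eq_wave`). Conversely, the wave is an entropy solution
(`IsWaveSpeed.isEntropySolution`), by an integration by parts along this line (`integral_wave`).

*The junction.* The flow of an admissible boundary value is at most the demand or supply of the
link, and the flow determines the boundary density (`IsAdmissibleTrace.eq_of_flux_eq`). The turning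
ratios fix all flows in terms of the one into the junction, so the largest possible flow is the
minimum in the theorem. It is realized by the waves on the links, whose balances at the
junction add up to zero, and maximality leaves no other choice of the flow, hence of the densities.
-/

namespace TrafficJunction

/-! ### Cutoff functions -/

theorem hasDerivAt_fderiv_time {φ : ℝ × ℝ → ℝ} (hφ : ContDiff ℝ ∞ φ) (t x : ℝ) :
    HasDerivAt (fun τ => φ (τ, x)) (fderiv ℝ φ (t, x) (1, 0)) t := by
  have h1 : HasFDerivAt φ (fderiv ℝ φ (t, x)) (t, x) :=
    (hφ.differentiable (by simp) (t, x)).hasFDerivAt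
  have h2 : HasDerivAt (fun τ : ℝ => (τ, x)) ((1 : ℝ), (0 : ℝ)) t :=
    (hasDerivAt_id t).prodMk (hasDerivAt_const t x)
  exact h1.comp_hasDerivAt t h2

theorem hasDerivAt_fderiv_space {φ : ℝ × ℝ → ℝ} (hφ : ContDiff ℝ ∞ φ) (t x : ℝ) :
    HasDerivAt (fun y => φ (t, y)) (fderiv ℝ φ (t, x) (0, 1)) x := by
  have h1 : HasFDerivAt φ (fderiv ℝ φ (t, x)) (t, x) :=
    (hφ.differentiable (by simp) (t, x)).hasFDerivAt
  have h2 : HasDerivAt (fun y : ℝ => (t, y)) ((0 : ℝ), (1 : ℝ)) x :=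
    (hasDerivAt_const x t).prodMk (hasDerivAt_id x)
  exact h1.comp_hasDerivAt x h2

theorem continuous_fderiv_apply {φ : ℝ × ℝ → ℝ} (hφ : ContDiff ℝ ∞ φ) (v : ℝ × ℝ) :
    Continuous fun p => fderiv ℝ φ p v :=
  (hφ.continuous_fderiv (by simp)).clm_apply continuous_const

theorem hasCompactSupport_fderiv_apply {φ : ℝ × ℝ → ℝ} (hφ : HasCompactSupport φ)
    (v : ℝ × ℝ) : HasCompactSupport fun p => fderiv ℝ φ p v :=
  (hφ.fderiv ℝ).comp_left (g := fun L : ℝ × ℝ →L[ℝ] ℝ => L v) (by simp)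

theorem contDiff_smoothTransition : ContDiff ℝ ∞ Real.smoothTransition :=
  Real.smoothTransition.contDiff

theorem hasDerivAt_smoothTransition (y : ℝ) :
    HasDerivAt Real.smoothTransition (deriv Real.smoothTransition y) y :=
  (contDiff_smoothTransition.differentiable (by simp) y).hasDerivAt

theorem deriv_smoothTransition_nonneg (y : ℝ) : 0 ≤ deriv Real.smoothTransition y :=
  Real.smoothTransition.monotone.deriv_nonneg

theorem continuous_deriv_smoothTransition : Continuous (deriv Real.smoothTransition) :=
  contDiff_smoothTransition.continuous_deriv (by simp)

theorem deriv_smoothTransition_of_neg {y : ℝ} (hy : y < 0) :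
    deriv Real.smoothTransition y = 0 := by
  have : Real.smoothTransition =ᶠ[𝓝 y] fun _ => (0 : ℝ) := by
    filter_upwards [Iio_mem_nhds hy] with z hz
    exact Real.smoothTransition.zero_of_nonpos (le_of_lt hz)
  rw [this.deriv_eq, deriv_const]

theorem deriv_smoothTransition_of_one_lt {y : ℝ} (hy : 1 < y) :
    deriv Real.smoothTransition y = 0 := by
  have : Real.smoothTransition =ᶠ[𝓝 y] fun _ => (1 : ℝ) := by
    filter_upwards [Ioi_mem_nhds hy] with z hz
    exact Real.smoothTransition.one_of_one_le (le_of_lt hz)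
  rw [this.deriv_eq, deriv_const]

/-- A smooth step that vanishes up to `1 / n` and equals `1` from `2 / n` on. -/
noncomputable def ramp (n : ℕ) (y : ℝ) : ℝ := Real.smoothTransition (n * y - 1)

/-- The derivative of `ramp n`, a bump of mass `1` on `[1 / n, 2 / n]`. -/
noncomputable def rampDeriv (n : ℕ) (y : ℝ) : ℝ := n * deriv Real.smoothTransition (n * y - 1)

theorem contDiff_ramp (n : ℕ) : ContDiff ℝ ∞ (ramp n) :=
  contDiff_smoothTransition.comp ((contDiff_const.mul contDiff_id).sub contDiff_const)

theorem hasDerivAt_ramp (n : ℕ) (y : ℝ) : HasDerivAt (ramp n) (rampDeriv n y) y := by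
  have h : HasDerivAt (fun y : ℝ => (n : ℝ) * y - 1) (n : ℝ) y := by
    simpa using ((hasDerivAt_id y).const_mul (n : ℝ)).sub_const 1
  have := (hasDerivAt_smoothTransition (n * y - 1)).comp y h
  rw [mul_comm] at this
  exact this

theorem ramp_nonneg (n : ℕ) (y : ℝ) : 0 ≤ ramp n y := Real.smoothTransition.nonneg _

theorem ramp_le_one (n : ℕ) (y : ℝ) : ramp n y ≤ 1 := Real.smoothTransition.le_one _

theorem continuous_ramp (n : ℕ) : Continuous (ramp n) := (contDiff_ramp n).continuous

theorem rampDeriv_nonneg (n : ℕ) (y : ℝ) : 0 ≤ rampDeriv n y :=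
  mul_nonneg (Nat.cast_nonneg n) (deriv_smoothTransition_nonneg _)

theorem continuous_rampDeriv (n : ℕ) : Continuous (rampDeriv n) :=
  continuous_const.mul (continuous_deriv_smoothTransition.comp (by fun_prop))

theorem ramp_eq_zero {n : ℕ} {y : ℝ} (h : n * y ≤ 1) : ramp n y = 0 :=
  Real.smoothTransition.zero_of_nonpos (by linarith)

theorem tendsto_ramp {y : ℝ} (hy : 0 < y) : Tendsto (fun n => ramp n y) atTop (𝓝 1) := by
  refine tendsto_const_nhds.congr' ?_
  have h : Tendsto (fun n : ℕ => (n : ℝ) * y) atTop atTop :=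
    tendsto_natCast_atTop_atTop.atTop_mul_const hy
  filter_upwards [h.eventually_ge_atTop 2] with n hn
  exact (Real.smoothTransition.one_of_one_le (by linarith)).symm

theorem rampDeriv_eq_zero_of_lt {n : ℕ} {y δ : ℝ} (hn : 2 < n * δ) (hy : δ ≤ y) :
    rampDeriv n y = 0 := by
  have : (n : ℝ) * δ ≤ n * y := by gcongr
  rw [rampDeriv, deriv_smoothTransition_of_one_lt (by linarith), mul_zero]

theorem intervalIntegral_rampDeriv {n : ℕ} (hn : 2 ≤ n) {c : ℝ} (hc : 1 ≤ c) :
    ∫ y in (0 : ℝ)..c, rampDeriv n y = 1 := by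
  rw [intervalIntegral.integral_eq_sub_of_hasDerivAt (fun y _ => hasDerivAt_ramp n y)
    ((continuous_rampDeriv n).intervalIntegrable _ _)]
  have h2 : (2 : ℝ) ≤ n := by exact_mod_cast hn
  rw [ramp, ramp, Real.smoothTransition.one_of_one_le (by nlinarith),
    Real.smoothTransition.zero_of_nonpos (by simp), sub_zero]

theorem integrableOn_rampDeriv {n : ℕ} (hn : 3 ≤ n) : IntegrableOn (rampDeriv n) (Ioi 0) := by
  rw [← Ioc_union_Ioi_eq_Ioi (zero_le_one' ℝ)]
  refine IntegrableOn.union ((continuous_rampDeriv n).integrableOn_Ioc) ?_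
  refine (integrableOn_zero (s := Ioi (1 : ℝ))).congr_fun (fun y hy => ?_) measurableSet_Ioi
  have h3 : (3 : ℝ) ≤ n := by exact_mod_cast hn
  exact (rampDeriv_eq_zero_of_lt (δ := 1) (by linarith) (le_of_lt hy)).symm

theorem integral_rampDeriv {n : ℕ} (hn : 3 ≤ n) : ∫ y in Ioi (0 : ℝ), rampDeriv n y = 1 := by
  rw [← intervalIntegral_rampDeriv (n := n) (by omega) le_rfl,
    intervalIntegral.integral_of_le zero_le_one]
  refine (setIntegral_eq_of_subset_of_forall_sdiff_eq_zero measurableSet_Ioi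
    Ioc_subset_Ioi_self fun y hy => ?_)
  have h3 : (3 : ℝ) ≤ n := by exact_mod_cast hn
  refine rampDeriv_eq_zero_of_lt (δ := 1) (by linarith) ?_
  by_contra h
  exact hy.2 ⟨hy.1, le_of_lt (not_le.mp h)⟩

/-- Integration against `rampDeriv n` picks the right limit at `0`. -/
theorem tendsto_integral_rampDeriv_mul {g : ℝ → ℝ} {L : ℝ} (hg : IntegrableOn g (Ioi 0))
    (hL : Tendsto g (𝓝[>] 0) (𝓝 L)) :
    Tendsto (fun n => ∫ y in Ioi (0 : ℝ), rampDeriv n y * g y) atTop (𝓝 L) := by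
  have := tendsto_setIntegral_peak_smul_of_integrableOn_of_tendsto (μ := volume) (x₀ := (0 : ℝ))
    (s := Ioi 0) (φ := rampDeriv) (l := atTop) (g := g) (a := L) measurableSet_Ioi
    (t := Ioc 0 1) measurableSet_Ioc Ioc_subset_Ioi_self (Ioc_mem_nhdsGT one_pos) (by simp)
    (Eventually.of_forall fun n x _ => rampDeriv_nonneg n x) ?_ ?_
    (Eventually.of_forall fun n => (continuous_rampDeriv n).aestronglyMeasurable) hg hL
  · simpa using this
  · intro u hu h0
    obtain ⟨δ, hδ, hδu⟩ := Metric.isOpen_iff.1 hu 0 h0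
    refine Metric.tendstoUniformlyOn_iff.2 fun ε hε => ?_
    have h : Tendsto (fun n : ℕ => (n : ℝ) * δ) atTop atTop :=
      tendsto_natCast_atTop_atTop.atTop_mul_const hδ
    filter_upwards [h.eventually_gt_atTop 2] with n hn y hy
    have hy' : δ ≤ y := by
      by_contra hlt
      refine hy.2 (hδu ?_)
      have h0 : 0 < y := hy.1
      rw [Metric.mem_ball, Real.dist_eq, sub_zero, abs_of_pos h0]
      exact not_le.mp hlt
    rw [rampDeriv_eq_zero_of_lt hn hy']
    simpa using hε
  · refine tendsto_const_nhds.congr' ?_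
    filter_upwards [eventually_ge_atTop 2] with n hn
    rw [← intervalIntegral.integral_of_le zero_le_one, intervalIntegral_rampDeriv hn le_rfl]

/-- Bounds an integral against `rampDeriv n`, since this function has mass `1`. -/
theorem abs_integral_rampDeriv_mul_le {g : ℝ → ℝ} {C : ℝ} {n : ℕ} (hn : 3 ≤ n)
    (hC : ∀ y, |g y| ≤ C) : |∫ y in Ioi (0 : ℝ), rampDeriv n y * g y| ≤ C := by
  have h1 : ∫ y in Ioi (0 : ℝ), rampDeriv n y * C = C := by
    rw [integral_mul_const, integral_rampDeriv hn, one_mul]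
  rw [← h1, ← Real.norm_eq_abs]
  refine norm_integral_le_of_norm_le ((integrableOn_rampDeriv hn).mul_const C)
    (Eventually.of_forall fun y => ?_)
  rw [Real.norm_eq_abs, abs_mul, abs_of_nonneg (rampDeriv_nonneg n y)]
  exact mul_le_mul_of_nonneg_left (hC y) (rampDeriv_nonneg n y)

/-- A smooth nonnegative function of time that vanishes from `T` on and strictly decreases
before. -/
theorem exists_time_weight (T : ℝ) : ∃ g g' : ℝ → ℝ, ContDiff ℝ ∞ g ∧
    (∀ t, HasDerivAt g (g' t) t) ∧ (∀ t, 0 ≤ g t) ∧ (∀ t, T ≤ t → g t = 0) ∧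
    (∀ t, g' t ≤ 0) ∧ ∀ t < T, g' t < 0 := by
  have hneg : ∀ t < T, -Real.smoothTransition (T - t)
      - (T - t) * deriv Real.smoothTransition (T - t) < 0 := by
    intro t ht
    have h1 := Real.smoothTransition.pos_of_pos (sub_pos.2 ht)
    have h2 := mul_nonneg (sub_pos.2 ht).le (deriv_smoothTransition_nonneg (T - t))
    linarith
  refine ⟨fun t => (T - t) * Real.smoothTransition (T - t), fun t =>
    -Real.smoothTransition (T - t) - (T - t) * deriv Real.smoothTransition (T - t),
    ?_, fun t => ?_, fun t => ?_, fun t ht => ?_, fun t => ?_, hneg⟩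
  · exact (contDiff_const.sub contDiff_id).mul
      (contDiff_smoothTransition.comp (contDiff_const.sub contDiff_id))
  · have h : HasDerivAt (fun t : ℝ => T - t) (-1) t := by
      simpa using (hasDerivAt_id t).const_sub T
    have := h.mul ((hasDerivAt_smoothTransition (T - t)).comp t h)
    refine this.congr_deriv ?_
    simp only [Function.comp_apply]
    ring
  · rcases le_total t T with h | h
    · exact mul_nonneg (sub_nonneg.2 h) (Real.smoothTransition.nonneg _)
    · simp [Real.smoothTransition.zero_of_nonpos (sub_nonpos.2 h)]
  · simp [Real.smoothTransition.zero_of_nonpos (sub_nonpos.2 ht)]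
  · rcases lt_trichotomy t T with h | h | h
    · exact (hneg t h).le
    · simp [h]
    · simp [Real.smoothTransition.zero_of_nonpos (sub_nonpos.2 h.le),
        deriv_smoothTransition_of_neg (sub_neg.2 h)]

/-! ### Entropy inequalities up to the boundary -/

/-- The density `r` satisfies the entropy inequality `∂ₜ U(r) + ∂ₓ G(r) ≤ 0` in the interior of
`(0, ∞) × I`, in the sense of distributions. -/
def EntropyIneq (I : Set ℝ) (r : ℝ → ℝ → ℝ) (U G : ℝ → ℝ) : Prop :=
  ∀ φ : ℝ × ℝ → ℝ, ContDiff ℝ ∞ φ → HasCompactSupport φ → tsupport φ ⊆ Ioi 0 ×ˢ I →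
    (∀ p, 0 ≤ φ p) →
    0 ≤ ∫ p in Ioi 0 ×ˢ I, (U (r p.1 p.2) * fderiv ℝ φ p (1, 0)
      + G (r p.1 p.2) * fderiv ℝ φ p (0, 1))

theorem exists_abs_le_on_Icc {U : ℝ → ℝ} (hU : Continuous U) (c : ℝ) :
    ∃ C, 0 ≤ C ∧ ∀ y ∈ Icc 0 c, |U y| ≤ C := by
  obtain ⟨C, hC⟩ := isCompact_Icc.exists_bound_of_continuousOn (hU.continuousOn (s := Icc 0 c))
  exact ⟨max C 0, le_max_right _ _, fun y hy => (hC y hy).trans (le_max_left _ _)⟩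

theorem hasCompactSupport_slice {φ : ℝ × ℝ → ℝ} (hφ : HasCompactSupport φ) (t : ℝ) :
    HasCompactSupport fun x => φ (t, x) := by
  refine HasCompactSupport.of_support_subset_isCompact
    (hφ.isCompact.image continuous_snd) fun x hx => ?_
  exact ⟨(t, x), subset_tsupport _ hx, rfl⟩

section

variable {F : Diagram} {I : Set ℝ} {r0 : ℝ} {r : ℝ → ℝ → ℝ}

theorem IsEntropySolution.integrable_comp_mul (hr : IsEntropySolution F I r0 r) (hI : IsOpen I)
    {U : ℝ → ℝ} (hU : Continuous U) {φ : ℝ × ℝ → ℝ} (hφ : Continuous φ)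
    (hc : HasCompactSupport φ) :
    Integrable (fun p : ℝ × ℝ => U (r p.1 p.2) * φ p) (volume.restrict (Ioi 0 ×ˢ I)) := by
  obtain ⟨C, -, hC⟩ := exists_abs_le_on_Icc hU F.rhoJam
  refine (hφ.integrable_of_hasCompactSupport hc).integrableOn.bdd_mul (c := C)
    (hU.comp_aestronglyMeasurable hr.measurable) ?_
  refine (ae_restrict_iff' (measurableSet_Ioi.prod hI.measurableSet)).2
    (Eventually.of_forall fun p hp => ?_)
  exact hC _ (hr.mem_range p.1 (le_of_lt hp.1) p.2 hp.2)

theorem IsEntropySolution.integrable_slice_mul (hr : IsEntropySolution F I r0 r) (hI : IsOpen I)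
    {U : ℝ → ℝ} (hU : Continuous U) {t : ℝ} (ht : 0 ≤ t) {φ : ℝ → ℝ} (hφ : Continuous φ)
    (hc : HasCompactSupport φ) :
    Integrable (fun x => U (r t x) * φ x) (volume.restrict I) := by
  obtain ⟨C, -, hC⟩ := exists_abs_le_on_Icc hU F.rhoJam
  refine (hφ.integrable_of_hasCompactSupport hc).integrableOn.bdd_mul (c := C)
    (hU.comp_aestronglyMeasurable (hr.measurable_slice t ht)) ?_
  refine (ae_restrict_iff' hI.measurableSet).2 (Eventually.of_forall fun x hx => ?_)
  exact hC _ (hr.mem_range t ht x hx)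

/-- The weighted entropy of an entropy solution tends to zero at the initial time if the initial
entropy vanishes on the support of the weight. -/
theorem IsEntropySolution.tendsto_integral_initial (hr : IsEntropySolution F I r0 r)
    (hI : IsOpen I) {U : ℝ → ℝ} (hU : ∀ y z, |U y - U z| ≤ |y - z|)
    {φ : ℝ × ℝ → ℝ} (hφ : Continuous φ) (hc : HasCompactSupport φ) (h0 : ∀ p, 0 ≤ φ p)
    (hs : ∀ p ∈ tsupport φ, 0 ≤ p.1 → p.2 ∈ I) (hinit : ∀ x ∈ I, U r0 * φ (0, x) = 0) :
    Tendsto (fun t => ∫ x in I, U (r t x) * φ (t, x)) (𝓝[>] 0) (𝓝 0) := by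
  obtain ⟨C, hC⟩ := hφ.bounded_above_of_compact_support hc
  have hC' : ∀ p, φ p ≤ C := fun p => (le_abs_self _).trans (hC p)
  have hC0 : 0 ≤ C := (h0 (0, 0)).trans (hC' _)
  set K : Set ℝ := Prod.snd '' (tsupport φ ∩ {p | 0 ≤ p.1}) with hK
  have hKc : IsCompact K :=
    (hc.isCompact.inter_right (isClosed_le continuous_const continuous_fst)).image continuous_snd
  have hKI : K ⊆ I := by
    rintro x ⟨p, hp, rfl⟩
    exact hs p hp.1 hp.2
  have hslice : ∀ t, Continuous fun x => φ (t, x) := fun t => by fun_prop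
  -- the part that comes from the initial state
  have h1 : Tendsto (fun t => |U r0| * ∫ x in I, φ (t, x)) (𝓝[>] 0) (𝓝 0) := by
    have hz : |U r0| * ∫ x in I, φ (0, x) = 0 := by
      rw [← integral_const_mul]
      rw [setIntegral_congr_fun (g := fun _ => (0 : ℝ)) hI.measurableSet fun x hx => ?_]
      · simp
      · have := hinit x hx
        rcases mul_eq_zero.1 this with h | h <;> simp [h]
    suffices h : Tendsto (fun t => |U r0| * ∫ x in I, φ (t, x)) (𝓝[>] 0)
        (𝓝 (|U r0| * ∫ x in I, φ (0, x))) by rwa [hz] at h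
    refine Tendsto.const_mul _ ?_
    have hK2 : IsCompact (Prod.snd '' tsupport φ) := hc.isCompact.image continuous_snd
    refine tendsto_integral_filter_of_dominated_convergence
      ((Prod.snd '' tsupport φ).indicator fun _ => C)
      (Eventually.of_forall fun t => (hslice t).aestronglyMeasurable)
      (Eventually.of_forall fun t => Eventually.of_forall fun x => ?_) ?_
      (Eventually.of_forall fun x => ?_)
    · by_cases hx : x ∈ Prod.snd '' tsupport φ
      · rw [indicator_of_mem hx]; exact hC _
      · rw [indicator_of_notMem hx]
        have : φ (t, x) = 0 := by
          by_contra h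
          exact hx ⟨(t, x), subset_tsupport _ h, rfl⟩
        simp [this]
    · exact ((integrable_indicator_iff hK2.measurableSet).2
        (integrableOn_const hK2.measure_lt_top.ne)).integrableOn
    · have : Continuous fun t => φ (t, x) := by fun_prop
      exact (this.tendsto 0).mono_left nhdsWithin_le_nhds
  -- the part that comes from the deviation from the initial state
  have h2 : Tendsto (fun t => C * ∫ x in K, |r t x - r0|) (𝓝[>] 0) (𝓝 0) := by
    suffices h : Tendsto (fun t => ∫ x in K, |r t x - r0|) (𝓝[>] 0) (𝓝 0) by
      simpa using h.const_mul C
    have h := (hr.continuous 0 le_rfl K hKc hKI).mono_left (nhdsWithin_mono 0 Ioi_subset_Ici_self)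
    refine h.congr fun t => integral_congr_ae ?_
    filter_upwards [ae_restrict_of_ae_restrict_of_subset hKI hr.initial] with x hx
    rw [hx]
  refine squeeze_zero_norm' ?_ (by simpa using h1.add h2)
  filter_upwards [self_mem_nhdsWithin] with t ht
  have ht0 : 0 ≤ t := le_of_lt ht
  have hi1 : Integrable (fun x => |U r0| * φ (t, x)) (volume.restrict I) :=
    (((hslice t).integrable_of_hasCompactSupport
      (hasCompactSupport_slice hc t)).integrableOn).const_mul _
  have hi2 : Integrable (fun x => |r t x - r0| * φ (t, x)) (volume.restrict I) :=
    hr.integrable_slice_mul hI (U := fun y => |y - r0|) (by fun_prop) ht0 (hslice t)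
      (hasCompactSupport_slice hc t)
  have hi3 : IntegrableOn (fun x => |r t x - r0|) K := by
    refine IntegrableOn.of_bound hKc.measure_lt_top ?_ (F.rhoJam + |r0|) ?_
    · exact ((continuous_abs.comp (continuous_sub_right r0)).comp_aestronglyMeasurable
        ((hr.measurable_slice t ht0).mono_set hKI))
    · refine (ae_restrict_iff' hKc.measurableSet).2 (Eventually.of_forall fun x hx => ?_)
      have := hr.mem_range t ht0 x (hKI hx)
      rw [Real.norm_eq_abs, abs_abs]
      refine (abs_sub _ _).trans ?_
      rw [abs_of_nonneg this.1]
      linarith [this.2]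
  calc ‖∫ x in I, U (r t x) * φ (t, x)‖
      ≤ ∫ x in I, (|U r0| * φ (t, x) + |r t x - r0| * φ (t, x)) := by
        refine norm_integral_le_of_norm_le (hi1.add hi2) (Eventually.of_forall fun x => ?_)
        rw [Real.norm_eq_abs, abs_mul, abs_of_nonneg (h0 _), ← add_mul]
        refine mul_le_mul_of_nonneg_right ?_ (h0 _)
        have h1 := hU (r t x) r0
        have h2 := abs_add_le (U r0) (U (r t x) - U r0)
        rw [add_sub_cancel] at h2
        linarith
    _ = |U r0| * (∫ x in I, φ (t, x)) + ∫ x in I, |r t x - r0| * φ (t, x) := by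
        rw [integral_add hi1 hi2, integral_const_mul]
    _ ≤ |U r0| * (∫ x in I, φ (t, x)) + C * ∫ x in K, |r t x - r0| := by
        gcongr
        rw [← integral_const_mul]
        have hsub : ∫ x in I, |r t x - r0| * φ (t, x) = ∫ x in K, |r t x - r0| * φ (t, x) := by
          refine setIntegral_eq_of_subset_of_forall_sdiff_eq_zero hI.measurableSet hKI ?_
          intro x hx
          have : φ (t, x) = 0 := by
            by_contra h
            exact hx.2 ⟨(t, x), ⟨subset_tsupport _ h, ht0⟩, rfl⟩
          rw [this, mul_zero]
        rw [hsub]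
        refine integral_mono (hi2.mono_measure (Measure.restrict_mono hKI le_rfl))
          (hi3.const_mul C) fun x => ?_
        show |r t x - r0| * φ (t, x) ≤ C * |r t x - r0|
        rw [mul_comm]
        exact mul_le_mul_of_nonneg_right (hC' _) (abs_nonneg _)

/-- The entropy inequality extends to test functions that do not vanish at the initial time, if the
initial entropy vanishes on their support. -/
theorem EntropyIneq.up_to_initial {U G : ℝ → ℝ} (hE : EntropyIneq I r U G)
    (hr : IsEntropySolution F I r0 r) (hI : IsOpen I) (hU : ∀ y z, |U y - U z| ≤ |y - z|)
    (hUc : Continuous U) (hG : Continuous G)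
    {φ : ℝ × ℝ → ℝ} (hφ : ContDiff ℝ ∞ φ) (hc : HasCompactSupport φ) (h0 : ∀ p, 0 ≤ φ p)
    (hs : ∀ p ∈ tsupport φ, 0 ≤ p.1 → p.2 ∈ I) (hinit : ∀ x ∈ I, U r0 * φ (0, x) = 0) :
    0 ≤ ∫ p in Ioi 0 ×ˢ I, (U (r p.1 p.2) * fderiv ℝ φ p (1, 0)
      + G (r p.1 p.2) * fderiv ℝ φ p (0, 1)) := by
  have hIm := hI.measurableSet
  set E : ℝ × ℝ → ℝ := fun p => U (r p.1 p.2) * fderiv ℝ φ p (1, 0)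
      + G (r p.1 p.2) * fderiv ℝ φ p (0, 1) with hEdef
  have hEint : Integrable E (volume.restrict (Ioi 0 ×ˢ I)) :=
    (hr.integrable_comp_mul hI hUc (continuous_fderiv_apply hφ _)
      (hasCompactSupport_fderiv_apply hc _)).add
    (hr.integrable_comp_mul hI hG (continuous_fderiv_apply hφ _)
      (hasCompactSupport_fderiv_apply hc _))
  have hUint := hr.integrable_comp_mul hI hUc hφ.continuous hc
  have hprod : (volume.restrict (Ioi 0 ×ˢ I) : Measure (ℝ × ℝ))
      = (volume.restrict (Ioi 0)).prod (volume.restrict I) := by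
    rw [Measure.prod_restrict]; rfl
  set m : ℝ → ℝ := fun t => ∫ x in I, U (r t x) * φ (t, x) with hm
  have hmint : IntegrableOn m (Ioi 0) := by
    rw [hprod] at hUint
    exact hUint.integral_prod_left
  have hm0 := hr.tendsto_integral_initial hI hU hφ.continuous hc h0 hs hinit
  have hkey : ∀ n : ℕ, 0 ≤ (∫ p in Ioi 0 ×ˢ I, ramp n p.1 * E p)
      + ∫ t in Ioi (0 : ℝ), rampDeriv n t * m t := by
    intro n
    have hsm : ContDiff ℝ ∞ fun p : ℝ × ℝ => ramp n p.1 * φ p :=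
      ((contDiff_ramp n).comp contDiff_fst).mul hφ
    have h := hE (fun p => ramp n p.1 * φ p) hsm hc.mul_left ?_
      (fun p => mul_nonneg (ramp_nonneg n _) (h0 p))
    · have e2 : ∫ t in Ioi (0 : ℝ), rampDeriv n t * m t
          = ∫ p in Ioi 0 ×ˢ I, U (r p.1 p.2) * (rampDeriv n p.1 * φ p) := by
        have hi := hr.integrable_comp_mul hI hUc (φ := fun p => rampDeriv n p.1 * φ p)
          (((continuous_rampDeriv n).comp continuous_fst).mul hφ.continuous) hc.mul_left
        rw [hprod] at hi ⊢
        rw [integral_prod _ hi]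
        refine integral_congr_ae (Eventually.of_forall fun t => ?_)
        simp only [hm]
        rw [← integral_const_mul]
        refine integral_congr_ae (Eventually.of_forall fun x => ?_)
        simp only
        ring
      rw [e2, ← integral_add]
      · refine h.trans_eq (integral_congr_ae (Eventually.of_forall fun p => ?_))
        obtain ⟨t, x⟩ := p
        have d1 := (hasDerivAt_fderiv_time hsm t x).unique
          ((hasDerivAt_ramp n t).mul (hasDerivAt_fderiv_time hφ t x))
        have d2 := (hasDerivAt_fderiv_space hsm t x).unique
          ((hasDerivAt_fderiv_space hφ t x).const_mul (ramp n t))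
        simp only [hEdef, d1, d2]
        ring
      · refine hEint.bdd_mul (c := 1)
          (((continuous_ramp n).comp continuous_fst).aestronglyMeasurable)
          (Eventually.of_forall fun p => ?_)
        rw [Real.norm_eq_abs, abs_of_nonneg (ramp_nonneg n _)]
        exact ramp_le_one n _
      · exact hr.integrable_comp_mul hI hUc (φ := fun p => rampDeriv n p.1 * φ p)
          (((continuous_rampDeriv n).comp continuous_fst).mul hφ.continuous) hc.mul_left
    · intro p hp
      have hp1 : p ∈ tsupport φ := closure_mono (Function.support_mul_subset_right _ _) hp
      have hp2 : 1 ≤ n * p.1 := by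
        refine closure_minimal (t := {p : ℝ × ℝ | 1 ≤ n * p.1}) ?_
          (isClosed_le continuous_const (by fun_prop)) hp
        intro q hq
        by_contra hlt
        exact hq (by simp [ramp_eq_zero (le_of_lt (not_le.1 hlt))])
      have hp3 : 0 < p.1 := by
        by_contra hlt
        have := mul_nonpos_of_nonneg_of_nonpos (Nat.cast_nonneg (α := ℝ) n) (not_lt.1 hlt)
        linarith
      exact ⟨hp3, hs p hp1 hp3.le⟩
  have hlim1 : Tendsto (fun n => ∫ p in Ioi 0 ×ˢ I, ramp n p.1 * E p) atTop
      (𝓝 (∫ p in Ioi 0 ×ˢ I, E p)) := by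
    refine tendsto_integral_of_dominated_convergence (fun p => ‖E p‖) (fun n => ?_) hEint.norm
      (fun n => Eventually.of_forall fun p => ?_) ?_
    · exact (((continuous_ramp n).comp continuous_fst).aestronglyMeasurable).mul
        hEint.aestronglyMeasurable
    · rw [norm_mul, Real.norm_eq_abs (ramp n _), abs_of_nonneg (ramp_nonneg n _)]
      exact mul_le_of_le_one_left (norm_nonneg _) (ramp_le_one n _)
    · refine (ae_restrict_iff' (measurableSet_Ioi.prod hIm)).2
        (Eventually.of_forall fun p hp => ?_)
      simpa using (tendsto_ramp hp.1).mul_const (E p)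
  have := ge_of_tendsto' (hlim1.add (tendsto_integral_rampDeriv_mul hmint hm0)) hkey
  simpa using this

end

/-- The open interval of an incoming link with far end `a` and junction end `b`. -/
def incoming (a : EReal) (b : ℝ) : Set ℝ := {x | a < x ∧ x < b}

theorem isOpen_incoming (a : EReal) (b : ℝ) : IsOpen (incoming a b) :=
  (isOpen_lt continuous_const continuous_coe_real_ereal).inter
    (isOpen_lt continuous_id continuous_const)

section

variable {F : Diagram} {a : EReal} {b r0 z : ℝ} {r : ℝ → ℝ → ℝ}

/-- The entropy inequality extends to test functions that do not vanish at the junction end of the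
link, if the entropy flux of the boundary value has the right sign there. -/
theorem EntropyIneq.up_to_boundary {U G : ℝ → ℝ} (hE : EntropyIneq (incoming a b) r U G)
    (hr : IsEntropySolution F (incoming a b) r0 r)
    (hz : ∀ᵐ t ∂(volume.restrict (Ioi 0)), Tendsto (r t) (𝓝[<] b) (𝓝 z)) (hab : a < b)
    (hU : ∀ y z, |U y - U z| ≤ |y - z|) (hUc : Continuous U) (hG : Continuous G)
    {φ : ℝ × ℝ → ℝ} (hφ : ContDiff ℝ ∞ φ) (hc : HasCompactSupport φ) (h0 : ∀ p, 0 ≤ φ p)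
    (hs : ∀ p ∈ tsupport φ, 0 ≤ p.1 → a < p.2)
    (hinit : ∀ x < b, U r0 * φ (0, x) = 0) (hbdy : ∀ t, 0 < t → 0 ≤ G z * φ (t, b)) :
    0 ≤ ∫ p in Ioi 0 ×ˢ incoming a b, (U (r p.1 p.2) * fderiv ℝ φ p (1, 0)
      + G (r p.1 p.2) * fderiv ℝ φ p (0, 1)) := by
  have hI := isOpen_incoming a b
  set I := incoming a b with hIdef
  have hIm := hI.measurableSet
  set E : ℝ × ℝ → ℝ := fun p => U (r p.1 p.2) * fderiv ℝ φ p (1, 0)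
      + G (r p.1 p.2) * fderiv ℝ φ p (0, 1) with hEdef
  have hEint : Integrable E (volume.restrict (Ioi 0 ×ˢ I)) :=
    (hr.integrable_comp_mul hI hUc (continuous_fderiv_apply hφ _)
      (hasCompactSupport_fderiv_apply hc _)).add
    (hr.integrable_comp_mul hI hG (continuous_fderiv_apply hφ _)
      (hasCompactSupport_fderiv_apply hc _))
  have hprod : (volume.restrict (Ioi 0 ×ˢ I) : Measure (ℝ × ℝ))
      = (volume.restrict (Ioi 0)).prod (volume.restrict I) := by
    rw [Measure.prod_restrict]; rfl
  -- the flux through the layer of points at distance between `1 / n` and `2 / n` from `b`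
  set m : ℕ → ℝ → ℝ := fun n t => ∫ x in I, G (r t x) * (rampDeriv n (b - x) * φ (t, x)) with hm
  have hkc : ∀ n, Continuous fun p : ℝ × ℝ => rampDeriv n (b - p.2) * φ p := fun n =>
    ((continuous_rampDeriv n).comp (by fun_prop)).mul hφ.continuous
  have hmint : ∀ n, IntegrableOn (m n) (Ioi 0) := by
    intro n
    have := hr.integrable_comp_mul hI hG (hkc n) hc.mul_left
    rw [hprod] at this
    exact this.integral_prod_left
  have hkey : ∀ n : ℕ, 0 ≤ (∫ p in Ioi 0 ×ˢ I, ramp n (b - p.2) * E p)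
      - ∫ t in Ioi (0 : ℝ), m n t := by
    intro n
    have hsm : ContDiff ℝ ∞ fun p : ℝ × ℝ => ramp n (b - p.2) * φ p :=
      ((contDiff_ramp n).comp (contDiff_const.sub contDiff_snd)).mul hφ
    have h := hE.up_to_initial hr hI hU hUc hG hsm hc.mul_left
      (fun p => mul_nonneg (ramp_nonneg n _) (h0 p)) ?_ ?_
    · have e2 : ∫ t in Ioi (0 : ℝ), m n t
          = ∫ p in Ioi 0 ×ˢ I, G (r p.1 p.2) * (rampDeriv n (b - p.2) * φ p) := by
        have hi := hr.integrable_comp_mul hI hG (hkc n) hc.mul_left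
        rw [hprod] at hi ⊢
        rw [integral_prod _ hi]
      rw [e2, ← integral_sub]
      · refine h.trans_eq (integral_congr_ae (Eventually.of_forall fun p => ?_))
        obtain ⟨t, x⟩ := p
        have d1 := (hasDerivAt_fderiv_time hsm t x).unique
          ((hasDerivAt_fderiv_time hφ t x).const_mul (ramp n (b - x)))
        have hb : HasDerivAt (fun x => ramp n (b - x)) (-rampDeriv n (b - x)) x := by
          have := (hasDerivAt_ramp n (b - x)).comp x ((hasDerivAt_id x).const_sub b)
          simpa [Function.comp_def] using this
        have d2 := (hasDerivAt_fderiv_space hsm t x).unique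
          (hb.mul (hasDerivAt_fderiv_space hφ t x))
        simp only [hEdef, d1, d2]
        ring
      · refine hEint.bdd_mul (c := 1)
          (((continuous_ramp n).comp (continuous_const.sub continuous_snd)).aestronglyMeasurable)
          (Eventually.of_forall fun p => ?_)
        rw [Real.norm_eq_abs, abs_of_nonneg (ramp_nonneg n _)]
        exact ramp_le_one n _
      · exact hr.integrable_comp_mul hI hG (hkc n) hc.mul_left
    · intro p hp hp0
      have hp1 : p ∈ tsupport φ := closure_mono (Function.support_mul_subset_right _ _) hp
      have hp2 : 1 ≤ n * (b - p.2) := by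
        refine closure_minimal (t := {p : ℝ × ℝ | 1 ≤ n * (b - p.2)}) ?_
          (isClosed_le continuous_const (by fun_prop)) hp
        intro q hq
        by_contra hlt
        exact hq (by simp [ramp_eq_zero (le_of_lt (not_le.1 hlt))])
      refine ⟨hs p hp1 hp0, ?_⟩
      by_contra hlt
      have := mul_nonpos_of_nonneg_of_nonpos (Nat.cast_nonneg (α := ℝ) n)
        (sub_nonpos.2 (not_lt.1 hlt))
      linarith
    · intro x hx
      rw [mul_left_comm, hinit x hx.2, mul_zero]
  have hlim1 : Tendsto (fun n => ∫ p in Ioi 0 ×ˢ I, ramp n (b - p.2) * E p) atTop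
      (𝓝 (∫ p in Ioi 0 ×ˢ I, E p)) := by
    refine tendsto_integral_of_dominated_convergence (fun p => ‖E p‖) (fun n => ?_) hEint.norm
      (fun n => Eventually.of_forall fun p => ?_) ?_
    · exact (((continuous_ramp n).comp
        (continuous_const.sub continuous_snd)).aestronglyMeasurable).mul
        hEint.aestronglyMeasurable
    · rw [norm_mul, Real.norm_eq_abs (ramp n _), abs_of_nonneg (ramp_nonneg n _)]
      exact mul_le_of_le_one_left (norm_nonneg _) (ramp_le_one n _)
    · refine (ae_restrict_iff' (measurableSet_Ioi.prod hIm)).2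
        (Eventually.of_forall fun p hp => ?_)
      simpa using (tendsto_ramp (sub_pos.2 hp.2.2)).mul_const (E p)
  -- in terms of the distance `y = b - x` to the junction
  have hm' : ∀ n t, m n t = ∫ y in Ioi (0 : ℝ),
      rampDeriv n y * I.indicator (fun x => G (r t x) * φ (t, x)) (b - y) := by
    intro n t
    simp only [hm]
    rw [← integral_indicator hIm, ← integral_indicator measurableSet_Ioi,
      ← integral_sub_left_eq_self _ volume b]
    refine integral_congr_ae (Eventually.of_forall fun y => ?_)
    by_cases hy : b - y ∈ I
    · have : y ∈ Ioi (0 : ℝ) := by have := hy.2; rw [mem_Ioi]; linarith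
      simp only [indicator_of_mem this, indicator_of_mem hy, sub_sub_cancel]
      ring
    · beta_reduce
      rw [indicator_of_notMem hy]
      by_cases hy0 : y ∈ Ioi (0 : ℝ)
      · rw [indicator_of_mem hy0, indicator_of_notMem hy, mul_zero]
      · rw [indicator_of_notMem hy0]
  obtain ⟨CG, hCG0, hCG⟩ := exists_abs_le_on_Icc hG F.rhoJam
  obtain ⟨C, hC⟩ := hφ.continuous.bounded_above_of_compact_support hc
  have hbound : ∀ t, 0 < t → ∀ y,
      |I.indicator (fun x => G (r t x) * φ (t, x)) (b - y)| ≤ CG * C := by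
    intro t ht y
    by_cases hy : b - y ∈ I
    · rw [indicator_of_mem hy, abs_mul]
      exact mul_le_mul (hCG _ (hr.mem_range t ht.le _ hy)) (hC _) (abs_nonneg _) hCG0
    · rw [indicator_of_notMem hy, abs_zero]
      exact mul_nonneg hCG0 ((norm_nonneg _).trans (hC (0, 0)))
  have hlim2 : Tendsto (fun n => ∫ t in Ioi (0 : ℝ), m n t) atTop
      (𝓝 (∫ t in Ioi (0 : ℝ), G z * φ (t, b))) := by
    have hKc : IsCompact (Prod.fst '' tsupport φ) := hc.isCompact.image continuous_fst
    refine tendsto_integral_filter_of_dominated_convergence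
      ((Prod.fst '' tsupport φ).indicator fun _ => CG * C)
      (Eventually.of_forall fun n => (hmint n).aestronglyMeasurable) ?_ ?_ ?_
    · filter_upwards [eventually_ge_atTop 3] with n hn
      refine (ae_restrict_iff' measurableSet_Ioi).2 (Eventually.of_forall fun t ht => ?_)
      by_cases htK : t ∈ Prod.fst '' tsupport φ
      · rw [indicator_of_mem htK, hm', Real.norm_eq_abs]
        exact abs_integral_rampDeriv_mul_le hn (hbound t ht)
      · rw [indicator_of_notMem htK]
        have : ∀ x, φ (t, x) = 0 := fun x => by
          by_contra h
          exact htK ⟨(t, x), subset_tsupport _ h, rfl⟩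
        simp [hm, this]
    · exact ((integrable_indicator_iff hKc.measurableSet).2
        (integrableOn_const hKc.measure_lt_top.ne)).integrableOn
    · filter_upwards [hz, ae_restrict_mem measurableSet_Ioi] with t htz ht
      have ht0 : 0 < t := ht
      simp_rw [hm']
      refine tendsto_integral_rampDeriv_mul ?_ ?_
      · have h1 := hr.integrable_slice_mul hI hG ht0.le (φ := fun x => φ (t, x))
          (by have := hφ.continuous; fun_prop) (hasCompactSupport_slice hc t)
        have h2 := ((integrable_indicator_iff hIm).2 h1).comp_sub_left b
        exact h2.integrableOn
      · have h1 : Tendsto (fun y : ℝ => b - y) (𝓝[>] 0) (𝓝[<] b) := by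
          refine tendsto_nhdsWithin_iff.2 ⟨?_, ?_⟩
          · have : Tendsto (fun y : ℝ => b - y) (𝓝 0) (𝓝 (b - 0)) :=
              (continuous_const.sub continuous_id).tendsto 0
            rw [sub_zero] at this
            exact this.mono_left nhdsWithin_le_nhds
          · filter_upwards [self_mem_nhdsWithin] with y hy
            exact sub_lt_self b hy
        have h2 : Tendsto (fun x => G (r t x) * φ (t, x)) (𝓝[<] b) (𝓝 (G z * φ (t, b))) := by
          have hc1 : Continuous fun x => φ (t, x) := by have := hφ.continuous; fun_prop
          exact ((hG.tendsto z).comp htz).mul ((hc1.tendsto b).mono_left nhdsWithin_le_nhds)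
        have h3 : ∀ᶠ x in 𝓝[<] b, x ∈ I := by
          have hlt : ∀ᶠ x : ℝ in 𝓝 b, a < x :=
            (isOpen_lt continuous_const continuous_coe_real_ereal).mem_nhds hab
          filter_upwards [nhdsWithin_le_nhds hlt, self_mem_nhdsWithin] with x h h'
          exact ⟨h, h'⟩
        have h4 : Tendsto (I.indicator fun x => G (r t x) * φ (t, x)) (𝓝[<] b)
            (𝓝 (G z * φ (t, b))) := by
          refine h2.congr' ?_
          filter_upwards [h3] with x hx
          rw [indicator_of_mem hx]
        exact h4.comp h1
  have hge := ge_of_tendsto' (hlim1.sub hlim2) hkey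
  have hpos : 0 ≤ ∫ t in Ioi (0 : ℝ), G z * φ (t, b) :=
    setIntegral_nonneg measurableSet_Ioi fun t ht => hbdy t ht
  linarith

end

/-! ### Comparison -/

section

variable {F : Diagram} {a : EReal} {b r0 z : ℝ} {r : ℝ → ℝ → ℝ}

/-- The entropy vanishes in the region `x - F.vf * t > A`, `t < T`, on the side of the wall
`x = b + s * t` that is selected by the profile `ψ`, if no entropy enters this region: none through
the initial line, none through the junction, and none through the wall. Through the line
`x - F.vf * t = A` none can enter, since no wave is faster than `F.vf`.

The test function is a product of profiles for the parts of the boundary, with a weight that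
decreases in time: then all terms of the entropy balance are nonpositive, and must vanish. -/
theorem EntropyIneq.eq_zero_of_lt {U G : ℝ → ℝ} (hE : EntropyIneq (incoming a b) r U G)
    (hr : IsEntropySolution F (incoming a b) r0 r)
    (hz : ∀ᵐ t ∂(volume.restrict (Ioi 0)), Tendsto (r t) (𝓝[<] b) (𝓝 z)) (hab : a < b)
    (hU : ∀ y z, |U y - U z| ≤ |y - z|) (hUc : Continuous U) (hG : Continuous G)
    (hU0 : ∀ y, 0 ≤ U y) (hGU : ∀ y, G y ≤ F.vf * U y) (s : ℝ) {ψ : ℝ → ℝ}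
    (hψ : ContDiff ℝ ∞ ψ) (hψ0 : ∀ y, 0 ≤ ψ y) (hinit : ∀ y < 0, U r0 * ψ y = 0)
    (hbdy : ∀ t, 0 < t → 0 ≤ G z * ψ (-(s * t)))
    (hwall : ∀ᵐ p ∂(volume.restrict (Ioi 0 ×ˢ incoming a b)),
      a < ((p.2 - F.vf * p.1 : ℝ) : EReal) →
        deriv ψ (p.2 - s * p.1 - b) * (G (r p.1 p.2) - s * U (r p.1 p.2)) ≤ 0)
    {A : ℝ} (hA : a < A) (T : ℝ) :
    ∀ᵐ p ∂(volume.restrict (Ioi 0 ×ˢ incoming a b)), p.1 < T → A < p.2 - F.vf * p.1 →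
      0 < ψ (p.2 - s * p.1 - b) → U (r p.1 p.2) = 0 := by
  have hI := isOpen_incoming a b
  have hSm : MeasurableSet (Ioi (0 : ℝ) ×ˢ incoming a b) := measurableSet_Ioi.prod hI.measurableSet
  obtain ⟨g, g', hg, hgd, hg0, hgT, hg'0, hg'T⟩ := exists_time_weight T
  set h := Real.smoothTransition with hh
  set φ₀ : ℝ × ℝ → ℝ := fun p =>
    g p.1 * h (p.2 - F.vf * p.1 - A) * ψ (p.2 - s * p.1 - b) with hφ₀
  -- the second factor only serves to make the support compact
  set φ : ℝ × ℝ → ℝ := fun p => φ₀ p * (h (p.1 + 2) * h (b + 2 - p.2)) with hφ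
  have hhs : ContDiff ℝ ∞ h := contDiff_smoothTransition
  have hφs : ContDiff ℝ ∞ φ := by
    refine ContDiff.mul (ContDiff.mul (ContDiff.mul ?_ ?_) ?_) (ContDiff.mul ?_ ?_)
    · exact hg.comp contDiff_fst
    · exact hhs.comp (by fun_prop)
    · exact hψ.comp (by fun_prop)
    · exact hhs.comp (by fun_prop)
    · exact hhs.comp (by fun_prop)
  have hφ0 : ∀ p, 0 ≤ φ p := fun p =>
    mul_nonneg (mul_nonneg (mul_nonneg (hg0 _) (Real.smoothTransition.nonneg _)) (hψ0 _))
      (mul_nonneg (Real.smoothTransition.nonneg _) (Real.smoothTransition.nonneg _))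
  have hne : ∀ y, h y ≠ 0 → 0 < y := fun y hy => by
    by_contra hlt
    exact hy (Real.smoothTransition.zero_of_nonpos (not_lt.1 hlt))
  have hsupp : ∀ p, φ p ≠ 0 → p.1 ≤ T ∧ A ≤ p.2 - F.vf * p.1 ∧ -2 ≤ p.1 ∧ p.2 ≤ b + 2 := by
    intro p hp
    simp only [hφ, hφ₀, mul_ne_zero_iff] at hp
    obtain ⟨⟨⟨h1, h2⟩, -⟩, h4, h5⟩ := hp
    refine ⟨?_, ?_, ?_, ?_⟩
    · by_contra hlt
      exact h1 (hgT _ (le_of_lt (not_le.1 hlt)))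
    · linarith [hne _ h2]
    · linarith [hne _ h4]
    · linarith [hne _ h5]
  have hc : HasCompactSupport φ := by
    refine HasCompactSupport.of_support_subset_isCompact
      ((isCompact_Icc (a := (-2 : ℝ)) (b := T)).prod
        (isCompact_Icc (a := A - F.vf * 2) (b := b + 2))) fun p hp => ?_
    obtain ⟨h1, h2, h3, h4⟩ := hsupp p hp
    refine ⟨⟨h3, h1⟩, ?_, h4⟩
    have := mul_le_mul_of_nonneg_left h3 F.vf_pos.le
    linarith
  have hs : ∀ p ∈ tsupport φ, 0 ≤ p.1 → a < p.2 := by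
    intro p hp hp0
    have h1 : A ≤ p.2 - F.vf * p.1 := by
      refine closure_minimal (t := {p : ℝ × ℝ | A ≤ p.2 - F.vf * p.1}) ?_
        (isClosed_le continuous_const (by fun_prop)) hp
      intro q hq
      exact (hsupp q hq).2.1
    have h2 : A ≤ p.2 := by
      have := mul_nonneg F.vf_pos.le hp0
      linarith
    exact hA.trans_le (by exact_mod_cast h2)
  have hmain := hE.up_to_boundary hr hz hab hU hUc hG hφs hc hφ0 hs
    (fun x hx => ?_) (fun t ht => ?_)
  rotate_left
  · have := hinit (x - b) (by linarith)
    simp only [hφ, hφ₀, mul_zero, sub_zero]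
    rcases mul_eq_zero.1 this with h1 | h1 <;> simp [h1]
  · have h1 := hbdy t ht
    have h2 : b - s * t - b = -(s * t) := by ring
    simp only [hφ, hφ₀, h2]
    have h3 : 0 ≤ g t * h (b - F.vf * t - A) * (h (t + 2) * h (b + 2 - b)) :=
      mul_nonneg (mul_nonneg (hg0 _) (Real.smoothTransition.nonneg _))
        (mul_nonneg (Real.smoothTransition.nonneg _) (Real.smoothTransition.nonneg _))
    have := mul_nonneg h3 h1
    linarith
  -- the derivatives of the test function
  have hd1 : ∀ t x, 0 < t → x < b → fderiv ℝ φ (t, x) (1, 0) =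
      (g' t * h (x - F.vf * t - A) + g t * (deriv h (x - F.vf * t - A) * (-F.vf)))
        * ψ (x - s * t - b)
      + g t * h (x - F.vf * t - A) * (deriv ψ (x - s * t - b) * (-s)) := by
    intro t x ht hx
    have e1 : HasDerivAt (fun τ : ℝ => x - F.vf * τ - A) (-F.vf) t := by
      simpa using (((hasDerivAt_id t).const_mul F.vf).const_sub x).sub_const A
    have e2 : HasDerivAt (fun τ : ℝ => x - s * τ - b) (-s) t := by
      simpa using (((hasDerivAt_id t).const_mul s).const_sub x).sub_const b
    have e3 := ((hgd t).mul ((hasDerivAt_smoothTransition _).comp t e1)).mul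
      (((hψ.differentiable (by simp) _).hasDerivAt).comp t e2)
    refine (hasDerivAt_fderiv_time hφs t x).unique (e3.congr_of_eventuallyEq ?_)
    filter_upwards [Ioi_mem_nhds ht] with τ hτ
    have hτ0 : 0 < τ := hτ
    simp only [hφ, hφ₀, hh, Pi.mul_apply, Function.comp_apply]
    rw [Real.smoothTransition.one_of_one_le (by linarith : 1 ≤ τ + 2),
      Real.smoothTransition.one_of_one_le (by linarith : 1 ≤ b + 2 - x)]
    ring
  have hd2 : ∀ t x, 0 < t → x < b → fderiv ℝ φ (t, x) (0, 1) =
      g t * deriv h (x - F.vf * t - A) * ψ (x - s * t - b)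
      + g t * h (x - F.vf * t - A) * deriv ψ (x - s * t - b) := by
    intro t x ht hx
    have e1 : HasDerivAt (fun y : ℝ => y - F.vf * t - A) 1 x :=
      ((hasDerivAt_id x).sub_const _).sub_const A
    have e2 : HasDerivAt (fun y : ℝ => y - s * t - b) 1 x :=
      ((hasDerivAt_id x).sub_const _).sub_const b
    have e3 := (((hasDerivAt_smoothTransition _).comp x e1).const_mul (g t)).mul
      (((hψ.differentiable (by simp) _).hasDerivAt).comp x e2)
    simp only [mul_one] at e3
    refine (hasDerivAt_fderiv_space hφs t x).unique (e3.congr_of_eventuallyEq ?_)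
    filter_upwards [Iio_mem_nhds hx] with y hy
    have hy0 : y < b := hy
    simp only [hφ, hφ₀, hh, Pi.mul_apply, Function.comp_apply]
    rw [Real.smoothTransition.one_of_one_le (by linarith : 1 ≤ t + 2),
      Real.smoothTransition.one_of_one_le (by linarith : 1 ≤ b + 2 - y)]
    ring
  -- all contributions to the entropy balance have the same sign
  have hle : ∀ᵐ p ∂(volume.restrict (Ioi 0 ×ˢ incoming a b)),
      U (r p.1 p.2) * fderiv ℝ φ p (1, 0) + G (r p.1 p.2) * fderiv ℝ φ p (0, 1) ≤
        U (r p.1 p.2) * g' p.1 * h (p.2 - F.vf * p.1 - A) * ψ (p.2 - s * p.1 - b) := by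
    filter_upwards [hwall, ae_restrict_mem hSm] with p hw hp
    obtain ⟨t, x⟩ := p
    have ht : 0 < t := hp.1
    have hx : x < b := hp.2.2
    rw [hd1 t x ht hx, hd2 t x ht hx]
    simp only at hw ⊢
    have i1 : g t * deriv h (x - F.vf * t - A) * ψ (x - s * t - b)
        * (G (r t x) - F.vf * U (r t x)) ≤ 0 :=
      mul_nonpos_of_nonneg_of_nonpos (mul_nonneg (mul_nonneg (hg0 _)
        (deriv_smoothTransition_nonneg _)) (hψ0 _)) (sub_nonpos.2 (hGU _))
    have i2 : g t * h (x - F.vf * t - A) *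
        (deriv ψ (x - s * t - b) * (G (r t x) - s * U (r t x))) ≤ 0 := by
      by_cases h0 : h (x - F.vf * t - A) = 0
      · simp [h0]
      · refine mul_nonpos_of_nonneg_of_nonpos
          (mul_nonneg (hg0 _) (Real.smoothTransition.nonneg _)) (hw (hA.trans ?_))
        have := hne _ h0
        exact_mod_cast (by linarith : A < x - F.vf * t)
    linarith
  have hneg : ∀ p : ℝ × ℝ,
      U (r p.1 p.2) * g' p.1 * h (p.2 - F.vf * p.1 - A) * ψ (p.2 - s * p.1 - b) ≤ 0 := fun p =>
    mul_nonpos_of_nonpos_of_nonneg (mul_nonpos_of_nonpos_of_nonneg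
      (mul_nonpos_of_nonneg_of_nonpos (hU0 _) (hg'0 _)) (Real.smoothTransition.nonneg _)) (hψ0 _)
  have hEint := (hr.integrable_comp_mul hI hUc (continuous_fderiv_apply hφs (1, 0))
      (hasCompactSupport_fderiv_apply hc _)).add
    (hr.integrable_comp_mul hI hG (continuous_fderiv_apply hφs (0, 1))
      (hasCompactSupport_fderiv_apply hc _))
  have hzero := (integral_eq_zero_iff_of_nonneg_ae (μ := volume.restrict (Ioi 0 ×ˢ incoming a b))
    (f := fun p => -(U (r p.1 p.2) * fderiv ℝ φ p (1, 0) + G (r p.1 p.2) * fderiv ℝ φ p (0, 1)))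
    (by
      filter_upwards [hle] with p hp
      have := hp.trans (hneg p)
      exact neg_nonneg.2 this) hEint.neg).1 (by
        rw [integral_neg]
        refine le_antisymm (by linarith) ?_
        rw [neg_nonneg]
        refine integral_nonpos_of_ae ?_
        filter_upwards [hle] with p hp
        exact hp.trans (hneg p))
  filter_upwards [hle, hzero] with p h1 h2 hT hAp hψp
  have h2' : -(U (r p.1 p.2) * fderiv ℝ φ p (1, 0) + G (r p.1 p.2) * fderiv ℝ φ p (0, 1)) = 0 := h2
  have h3 : U (r p.1 p.2) * g' p.1 * h (p.2 - F.vf * p.1 - A) * ψ (p.2 - s * p.1 - b) = 0 :=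
    le_antisymm (hneg p) (by linarith)
  have h4 : h (p.2 - F.vf * p.1 - A) ≠ 0 :=
    (Real.smoothTransition.pos_of_pos (by linarith)).ne'
  have h5 := (hg'T p.1 hT).ne
  simpa [h4, h5, hψp.ne'] using h3

/-- The entropy vanishes where no wave from the far end can have arrived, on the side of the moving
wall where `ψ` is positive. -/
theorem EntropyIneq.eq_zero {U G : ℝ → ℝ} (hE : EntropyIneq (incoming a b) r U G)
    (hr : IsEntropySolution F (incoming a b) r0 r)
    (hz : ∀ᵐ t ∂(volume.restrict (Ioi 0)), Tendsto (r t) (𝓝[<] b) (𝓝 z)) (hab : a < b)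
    (hU : ∀ y z, |U y - U z| ≤ |y - z|) (hUc : Continuous U) (hG : Continuous G)
    (hU0 : ∀ y, 0 ≤ U y) (hGU : ∀ y, G y ≤ F.vf * U y) (s : ℝ) {ψ : ℝ → ℝ}
    (hψ : ContDiff ℝ ∞ ψ) (hψ0 : ∀ y, 0 ≤ ψ y) (hinit : ∀ y < 0, U r0 * ψ y = 0)
    (hbdy : ∀ t, 0 < t → 0 ≤ G z * ψ (-(s * t)))
    (hwall : ∀ᵐ p ∂(volume.restrict (Ioi 0 ×ˢ incoming a b)),
      a < ((p.2 - F.vf * p.1 : ℝ) : EReal) →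
        deriv ψ (p.2 - s * p.1 - b) * (G (r p.1 p.2) - s * U (r p.1 p.2)) ≤ 0) :
    ∀ᵐ p ∂(volume.restrict (Ioi 0 ×ˢ incoming a b)), a < ((p.2 - F.vf * p.1 : ℝ) : EReal) →
      0 < ψ (p.2 - s * p.1 - b) → U (r p.1 p.2) = 0 := by
  have h : ∀ᵐ p : ℝ × ℝ ∂(volume.restrict (Ioi 0 ×ˢ incoming a b)), ∀ (n : ℕ) (q : ℚ),
      a < ((q : ℝ) : EReal) → p.1 < n → (q : ℝ) < p.2 - F.vf * p.1 →
        0 < ψ (p.2 - s * p.1 - b) → U (r p.1 p.2) = 0 := by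
    refine ae_all_iff.2 fun n => ae_all_iff.2 fun q => ?_
    by_cases hq : a < ((q : ℝ) : EReal)
    · filter_upwards [hE.eq_zero_of_lt hr hz hab hU hUc hG hU0 hGU s hψ hψ0 hinit hbdy hwall hq n]
        with p hp _ using hp
    · exact Eventually.of_forall fun p h => absurd h hq
  filter_upwards [h] with p hp h1 h2
  obtain ⟨q, hq1, hq2⟩ := EReal.lt_iff_exists_rat_btwn.1 h1
  obtain ⟨n, hn⟩ := exists_nat_gt p.1
  exact hp n q hq1 hn (by exact_mod_cast hq2) h2

/-- The same without a moving wall. -/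
theorem EntropyIneq.eq_zero_of_boundary {U G : ℝ → ℝ} (hE : EntropyIneq (incoming a b) r U G)
    (hr : IsEntropySolution F (incoming a b) r0 r)
    (hz : ∀ᵐ t ∂(volume.restrict (Ioi 0)), Tendsto (r t) (𝓝[<] b) (𝓝 z)) (hab : a < b)
    (hU : ∀ y z, |U y - U z| ≤ |y - z|) (hUc : Continuous U) (hG : Continuous G)
    (hU0 : ∀ y, 0 ≤ U y) (hGU : ∀ y, G y ≤ F.vf * U y) (hinit : U r0 = 0) (hbdy : 0 ≤ G z) :
    ∀ᵐ p ∂(volume.restrict (Ioi 0 ×ˢ incoming a b)), a < ((p.2 - F.vf * p.1 : ℝ) : EReal) →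
      U (r p.1 p.2) = 0 := by
  filter_upwards [hE.eq_zero hr hz hab hU hUc hG hU0 hGU 0 (ψ := fun _ => 1) contDiff_const
    (fun _ => zero_le_one) (by simp [hinit]) (by simpa using fun _ _ => hbdy) (by simp)] with p hp h
  exact hp h one_pos

/-- A continuous function of the density that vanishes where no wave from the far end can have
arrived also vanishes at the boundary value. -/
theorem eq_zero_of_trace
    (hz : ∀ᵐ t ∂(volume.restrict (Ioi 0)), Tendsto (r t) (𝓝[<] b) (𝓝 z)) (hab : a < b)
    {U : ℝ → ℝ} (hUc : Continuous U)
    (h : ∀ᵐ p ∂(volume.restrict (Ioi 0 ×ˢ incoming a b)),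
      a < ((p.2 - F.vf * p.1 : ℝ) : EReal) → U (r p.1 p.2) = 0) : U z = 0 := by
  have hprod : (volume.restrict (Ioi 0 ×ˢ incoming a b) : Measure (ℝ × ℝ))
      = (volume.restrict (Ioi 0)).prod (volume.restrict (incoming a b)) := by
    rw [Measure.prod_restrict]; rfl
  rw [hprod] at h
  have h' := Measure.ae_ae_of_ae_prod h
  obtain ⟨A, hA, hAb⟩ := EReal.lt_iff_exists_real_btwn.1 hab
  have hAb' : A < b := by exact_mod_cast hAb
  have hpos : 0 < (b - A) / (2 * F.vf) := div_pos (by linarith) (by linarith [F.vf_pos])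
  -- a time at which the junction end of the link is out of reach of the far end
  obtain ⟨t, ht, htz, ht0⟩ : ∃ t ∈ Ioo 0 ((b - A) / (2 * F.vf)), Tendsto (r t) (𝓝[<] b) (𝓝 z) ∧
      ∀ᵐ x ∂(volume.restrict (incoming a b)),
        a < ((x - F.vf * t : ℝ) : EReal) → U (r t x) = 0 := by
    have hae := ae_restrict_of_ae_restrict_of_subset
      (Ioo_subset_Ioi_self : Ioo 0 ((b - A) / (2 * F.vf)) ⊆ Ioi 0) (hz.and h')
    have hmem := ae_restrict_mem (μ := volume)
      (measurableSet_Ioo : MeasurableSet (Ioo 0 ((b - A) / (2 * F.vf))))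
    have hne : (ae (volume.restrict (Ioo 0 ((b - A) / (2 * F.vf))))).NeBot := by
      rw [ae_neBot, Ne, Measure.restrict_eq_zero, Real.volume_Ioo]
      simpa using hpos
    obtain ⟨t, h1, h2⟩ := (hmem.and hae).exists
    exact ⟨t, h1, h2.1, h2.2⟩
  by_contra hne
  have h1 : ∀ᶠ x in 𝓝[<] b, U (r t x) ≠ 0 :=
    ((hUc.tendsto z).comp htz).eventually_ne hne
  have h2 : ∀ᶠ x in 𝓝[<] b, (A + b) / 2 < x :=
    nhdsWithin_le_nhds (Ioi_mem_nhds (by linarith))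
  obtain ⟨c, hcb, hc⟩ := (mem_nhdsLT_iff_exists_Ioo_subset' hAb').1 (h1.and h2)
  have hcb' : c < b := hcb
  have hsub : Ioo c b ⊆ incoming a b := by
    intro x hx
    have h3 := (hc hx).2
    refine ⟨hA.trans ?_, hx.2⟩
    exact_mod_cast (by linarith : A < x)
  have hfalse : ∀ᵐ x ∂(volume.restrict (Ioo c b)), False := by
    filter_upwards [ae_restrict_of_ae_restrict_of_subset hsub ht0,
      ae_restrict_mem measurableSet_Ioo] with x h3 hx
    refine (hc hx).1 (h3 (hA.trans ?_))
    have h4 : F.vf * t < (b - A) / 2 := by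
      have h5 := mul_lt_mul_of_pos_left ht.2 F.vf_pos
      have h6 : F.vf * ((b - A) / (2 * F.vf)) = (b - A) / 2 := by
        have := F.vf_pos.ne'
        field_simp
      linarith
    have h7 : (A + b) / 2 < x := (hc hx).2
    exact_mod_cast (by linarith : A < x - F.vf * t)
  rw [eventually_false_iff_eq_bot, ae_eq_bot, Measure.restrict_eq_zero, Real.volume_Ioo] at hfalse
  simp only [ENNReal.ofReal_eq_zero] at hfalse
  linarith

end

/-! ### Integration by parts on one side of a moving wall -/

/-- The change from the coordinates `(t, y)` that move with the wall to `(t, y + s * t)`. -/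
def shear (s : ℝ) : ℝ × ℝ ≃ₜ ℝ × ℝ where
  toFun p := (p.1, p.2 + s * p.1)
  invFun p := (p.1, p.2 - s * p.1)
  left_inv p := by simp
  right_inv p := by simp
  continuous_toFun := by fun_prop
  continuous_invFun := by fun_prop

/-- Integrals over `x < b + s * t`, in coordinates that move with the wall. -/
theorem integral_below_line_eq {f : ℝ × ℝ → ℝ} (hf : Continuous f) (hc : HasCompactSupport f)
    (b s : ℝ) : ∫ p in {p : ℝ × ℝ | p.2 < b + s * p.1}, f p =
      ∫ t, ∫ y in Iio b, f (t, y + s * t) := by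
  have hL : MeasurableSet {p : ℝ × ℝ | p.2 < b + s * p.1} :=
    (isOpen_lt (by fun_prop) (by fun_prop)).measurableSet
  rw [← integral_indicator hL, Measure.volume_eq_prod, integral_prod]
  · refine integral_congr_ae (Eventually.of_forall fun t => ?_)
    simp only
    rw [← integral_add_right_eq_self _ (s * t), ← integral_indicator measurableSet_Iio]
    refine integral_congr_ae (Eventually.of_forall fun y => ?_)
    simp [indicator_apply]
  · exact (hf.integrable_of_hasCompactSupport hc).indicator hL

theorem integral_below_line_fderiv_space {φ : ℝ × ℝ → ℝ} (hφ : ContDiff ℝ ∞ φ)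
    (hc : HasCompactSupport φ) (b s : ℝ) :
    ∫ p in {p : ℝ × ℝ | p.2 < b + s * p.1}, fderiv ℝ φ p (0, 1) = ∫ t, φ (t, b + s * t) := by
  rw [integral_below_line_eq (continuous_fderiv_apply hφ _) (hasCompactSupport_fderiv_apply hc _)]
  refine integral_congr_ae (Eventually.of_forall fun t => ?_)
  simp only
  have hd : ∀ y, HasDerivAt (fun y => φ (t, y + s * t)) (fderiv ℝ φ (t, y + s * t) (0, 1)) y := by
    intro y
    exact (hasDerivAt_fderiv_space hφ t (y + s * t)).comp_add_const y (s * t)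
  have hsm : ContDiff ℝ 1 fun y => φ (t, y + s * t) :=
    (hφ.comp (by fun_prop : ContDiff ℝ ∞ fun y : ℝ => (t, y + s * t))).of_le (by simp)
  have hcs : HasCompactSupport fun y => φ (t, y + s * t) :=
    (hasCompactSupport_slice hc t).comp_homeomorph (Homeomorph.addRight (s * t))
  rw [← integral_Iic_eq_integral_Iio, ← hcs.integral_Iic_deriv_eq hsm]
  exact integral_congr_ae (Eventually.of_forall fun y => (hd y).deriv.symm)

theorem integral_below_line_fderiv_time {φ : ℝ × ℝ → ℝ} (hφ : ContDiff ℝ ∞ φ)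
    (hc : HasCompactSupport φ) (b s : ℝ) :
    ∫ p in {p : ℝ × ℝ | p.2 < b + s * p.1}, fderiv ℝ φ p (1, 0) =
      -s * ∫ t, φ (t, b + s * t) := by
  -- the derivative along the wall integrates to zero
  have h0 : ∫ p in {p : ℝ × ℝ | p.2 < b + s * p.1}, fderiv ℝ φ p (1, s) = 0 := by
    have hcont := continuous_fderiv_apply hφ (1, s)
    have hcomp := hasCompactSupport_fderiv_apply hc (1, s)
    rw [integral_below_line_eq hcont hcomp, integral_integral_swap]
    · refine integral_eq_zero_of_ae (Eventually.of_forall fun y => ?_)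
      have hd : ∀ t,
          HasDerivAt (fun t => φ (t, y + s * t)) (fderiv ℝ φ (t, y + s * t) (1, s)) t := by
        intro t
        have h1 : HasFDerivAt φ (fderiv ℝ φ (t, y + s * t)) (t, y + s * t) :=
          (hφ.differentiable (by simp) _).hasFDerivAt
        have h2 : HasDerivAt (fun t : ℝ => (t, y + s * t)) ((1 : ℝ), s) t := by
          have := ((hasDerivAt_id t).const_mul s).const_add y
          rw [mul_one] at this
          exact (hasDerivAt_id t).prodMk this
        exact h1.comp_hasDerivAt t h2
      have hcurve : ∀ f : ℝ × ℝ → ℝ, Continuous f → HasCompactSupport f →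
          Integrable fun t => f (t, y + s * t) := by
        intro f hf hfc
        refine Continuous.integrable_of_hasCompactSupport (by fun_prop) ?_
        refine HasCompactSupport.of_support_subset_isCompact
          (hfc.isCompact.image continuous_fst) fun t ht => ?_
        exact ⟨(t, y + s * t), subset_tsupport _ ht, rfl⟩
      exact integral_eq_zero_of_hasDerivAt_of_integrable hd (hcurve _ hcont hcomp)
        (hcurve _ hφ.continuous hc)
    · have h1 : Integrable fun p : ℝ × ℝ => fderiv ℝ φ (p.1, p.2 + s * p.1) (1, s) :=
        Continuous.integrable_of_hasCompactSupport (by fun_prop)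
          (hcomp.comp_homeomorph (shear s))
      have h2 := h1.restrict (s := univ ×ˢ Iio b)
      rw [Measure.volume_eq_prod, ← Measure.prod_restrict, Measure.restrict_univ] at h2
      exact h2
  have hint : ∀ v, IntegrableOn (fun p => fderiv ℝ φ p v) {p : ℝ × ℝ | p.2 < b + s * p.1} :=
    fun v => ((continuous_fderiv_apply hφ v).integrable_of_hasCompactSupport
      (hasCompactSupport_fderiv_apply hc v)).integrableOn
  have hsplit : ∀ p, fderiv ℝ φ p (1, s) = fderiv ℝ φ p (1, 0) + s * fderiv ℝ φ p (0, 1) := by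
    intro p
    have : ((1 : ℝ), s) = (1, 0) + s • (0, 1) := by simp
    rw [this, map_add, map_smul, smul_eq_mul]
  simp_rw [hsplit] at h0
  rw [integral_add (hint _) ((hint _).const_mul s), integral_const_mul,
    integral_below_line_fderiv_space hφ hc] at h0
  linarith

/-- Integration by parts to the left of the wall `x = b + s * t`. Only the wall contributes, since
the test function vanishes near the initial line and near the far end. -/
theorem integral_left_of_wall {a : EReal} {b s : ℝ} (hs : s ≤ 0) {φ : ℝ × ℝ → ℝ}
    (hφ : ContDiff ℝ ∞ φ) (hc : HasCompactSupport φ)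
    (hsupp : tsupport φ ⊆ Ioi 0 ×ˢ {x : ℝ | a < x})
    (P G : ℝ) :
    ∫ p in Ioi 0 ×ˢ incoming a b ∩ {p | p.2 < b + s * p.1},
        (P * fderiv ℝ φ p (1, 0) + G * fderiv ℝ φ p (0, 1)) =
      (G - s * P) * ∫ t in Ioi 0, φ (t, b + s * t) := by
  have hint : ∀ v, IntegrableOn (fun p => fderiv ℝ φ p v) {p : ℝ × ℝ | p.2 < b + s * p.1} :=
    fun v => ((continuous_fderiv_apply hφ v).integrable_of_hasCompactSupport
      (hasCompactSupport_fderiv_apply hc v)).integrableOn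
  have hL : MeasurableSet {p : ℝ × ℝ | p.2 < b + s * p.1} :=
    (isOpen_lt (by fun_prop) (by fun_prop)).measurableSet
  rw [← setIntegral_eq_of_subset_of_forall_sdiff_eq_zero hL inter_subset_right]
  · rw [integral_add ((hint _).const_mul P) ((hint _).const_mul G), integral_const_mul,
      integral_const_mul, integral_below_line_fderiv_space hφ hc,
      integral_below_line_fderiv_time hφ hc]
    have : ∫ t, φ (t, b + s * t) = ∫ t in Ioi 0, φ (t, b + s * t) := by
      symm
      refine setIntegral_eq_integral_of_forall_compl_eq_zero fun t ht => ?_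
      by_contra h
      exact ht (hsupp (subset_tsupport _ h)).1
    rw [this]
    ring
  · intro p hp
    have hp' : p ∉ tsupport φ := by
      intro h
      have h1 := hsupp h
      have h2 : 0 < p.1 := h1.1
      have h3 : p.2 < b + s * p.1 := hp.1
      refine hp.2 ⟨⟨h1.1, h1.2, ?_⟩, hp.1⟩
      nlinarith
    have h0 : fderiv ℝ φ p = 0 := by
      by_contra h
      exact hp' (support_fderiv_subset ℝ h)
    simp [h0]

/-- The density with the constant values `r0` to the left and `z` to the right of the wall
`x = b + s * t`. -/
noncomputable def wave (b s r0 z : ℝ) (t x : ℝ) : ℝ := if x < b + s * t then r0 else z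

/-- The weak formulation for functions of a density with two constant states: there are
contributions from the junction end of the link and from the jump at the wall. -/
theorem integral_wave {a : EReal} {b s : ℝ} (hs : s ≤ 0) {φ : ℝ × ℝ → ℝ}
    (hφ : ContDiff ℝ ∞ φ) (hc : HasCompactSupport φ)
    (hsupp : tsupport φ ⊆ Ioi 0 ×ˢ {x : ℝ | a < x})
    (r0 z : ℝ) (U G : ℝ → ℝ) :
    ∫ p in Ioi 0 ×ˢ incoming a b, (U (wave b s r0 z p.1 p.2) * fderiv ℝ φ p (1, 0)
        + G (wave b s r0 z p.1 p.2) * fderiv ℝ φ p (0, 1)) =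
      G z * (∫ t in Ioi 0, φ (t, b)) +
        ((G r0 - s * U r0) - (G z - s * U z)) * ∫ t in Ioi 0, φ (t, b + s * t) := by
  have hint : ∀ (P Q : ℝ), Integrable (fun p =>
      P * fderiv ℝ φ p (1, 0) + Q * fderiv ℝ φ p (0, 1)) :=
    fun P Q => (((continuous_fderiv_apply hφ _).integrable_of_hasCompactSupport
      (hasCompactSupport_fderiv_apply hc _)).const_mul P).add
      (((continuous_fderiv_apply hφ _).integrable_of_hasCompactSupport
      (hasCompactSupport_fderiv_apply hc _)).const_mul Q)
  have hSm : MeasurableSet (Ioi (0 : ℝ) ×ˢ incoming a b) :=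
    measurableSet_Ioi.prod (isOpen_incoming a b).measurableSet
  have hL : MeasurableSet {p : ℝ × ℝ | p.2 < b + s * p.1} :=
    (isOpen_lt (by fun_prop) (by fun_prop)).measurableSet
  have hall := integral_left_of_wall (b := b) le_rfl hφ hc hsupp (U z) (G z)
  have hset : Ioi 0 ×ˢ incoming a b ∩ {p : ℝ × ℝ | p.2 < b + 0 * p.1}
      = Ioi (0 : ℝ) ×ˢ incoming a b := by
    refine inter_eq_left.2 fun p hp => ?_
    simpa using hp.2.2
  rw [hset] at hall
  have hleft := integral_left_of_wall (b := b) hs hφ hc hsupp (U r0 - U z) (G r0 - G z)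
  have hsplit : ∀ p : ℝ × ℝ, U (wave b s r0 z p.1 p.2) * fderiv ℝ φ p (1, 0)
        + G (wave b s r0 z p.1 p.2) * fderiv ℝ φ p (0, 1) =
      (U z * fderiv ℝ φ p (1, 0) + G z * fderiv ℝ φ p (0, 1)) +
        {p : ℝ × ℝ | p.2 < b + s * p.1}.indicator (fun p =>
          (U r0 - U z) * fderiv ℝ φ p (1, 0) + (G r0 - G z) * fderiv ℝ φ p (0, 1)) p := by
    intro p
    by_cases hp : p.2 < b + s * p.1
    · rw [indicator_of_mem (by exact hp), wave, if_pos hp]; ring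
    · rw [indicator_of_notMem (by exact hp), wave, if_neg hp, add_zero]
  simp_rw [hsplit]
  rw [integral_add (hint _ _).integrableOn ((hint _ _).integrableOn.indicator hL), hall,
    setIntegral_indicator hL, hleft]
  simp only [zero_mul, add_zero, sub_zero]
  ring

/-! ### The triangular flux -/

namespace Diagram

variable (F : Diagram)

theorem continuous_flux : Continuous F.flux := by
  unfold flux
  fun_prop

theorem crit_mul : F.crit * (F.vf + F.w) = F.w * F.rhoJam := by
  have := F.vf_pos
  have := F.w_pos
  rw [crit, div_mul_cancel₀]
  positivity

theorem crit_pos : 0 < F.crit := by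
  have := F.vf_pos
  have := F.w_pos
  have := F.rhoJam_pos
  unfold crit
  positivity

theorem crit_lt_rhoJam : F.crit < F.rhoJam := by
  have h1 := F.crit_mul
  have h2 := F.vf_pos
  have h3 := F.w_pos
  have h4 := F.rhoJam_pos
  have h5 : 0 < F.vf * F.rhoJam := by positivity
  nlinarith

theorem crit_mem : F.crit ∈ Icc 0 F.rhoJam := ⟨F.crit_pos.le, F.crit_lt_rhoJam.le⟩

variable {F}

theorem flux_of_le_crit {y : ℝ} (h : y ≤ F.crit) : F.flux y = F.vf * y := by
  have h1 := F.crit_mul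
  have h2 := add_pos F.vf_pos F.w_pos
  refine min_eq_left ?_
  nlinarith

theorem flux_of_crit_le {y : ℝ} (h : F.crit ≤ y) : F.flux y = F.w * (F.rhoJam - y) := by
  have h1 := F.crit_mul
  have h2 := add_pos F.vf_pos F.w_pos
  refine min_eq_right ?_
  nlinarith

theorem flux_crit : F.flux F.crit = F.capacity := by
  rw [flux_of_le_crit le_rfl, crit, capacity]
  ring

theorem flux_sub_flux_le {k y : ℝ} (h : k ≤ y) : F.flux y - F.flux k ≤ F.vf * (y - k) := by
  have hv := mul_nonneg F.vf_pos.le (sub_nonneg.2 h)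
  have hw := mul_nonneg F.w_pos.le (sub_nonneg.2 h)
  have h1 := min_le_left (F.vf * y) (F.w * (F.rhoJam - y))
  have h2 := min_le_right (F.vf * y) (F.w * (F.rhoJam - y))
  rcases min_choice (F.vf * k) (F.w * (F.rhoJam - k)) with h3 | h3 <;>
    simp only [flux, h3] <;> linarith

theorem le_flux_sub_flux {k y : ℝ} (h : k ≤ y) : -F.w * (y - k) ≤ F.flux y - F.flux k := by
  have hv := mul_nonneg F.vf_pos.le (sub_nonneg.2 h)
  have hw := mul_nonneg F.w_pos.le (sub_nonneg.2 h)
  have h1 := min_le_left (F.vf * k) (F.w * (F.rhoJam - k))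
  have h2 := min_le_right (F.vf * k) (F.w * (F.rhoJam - k))
  rcases min_choice (F.vf * y) (F.w * (F.rhoJam - y)) with h3 | h3 <;>
    simp only [flux, h3] <;> linarith

theorem sign_mul_flux_sub (k y : ℝ) :
    Real.sign (y - k) * (F.flux y - F.flux k) = F.flux (max y k) - F.flux (min y k) := by
  rcases lt_trichotomy y k with h | h | h
  · rw [Real.sign_of_neg (sub_neg.2 h), max_eq_right h.le, min_eq_left h.le]; ring
  · simp [h]
  · rw [Real.sign_of_pos (sub_pos.2 h), max_eq_left h.le, min_eq_right h.le]; ring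

end Diagram

/-! ### Kruzhkov entropies and semi-entropies -/

theorem abs_abs_sub_sub_abs_sub_le (k y z : ℝ) : |(|y - k|) - (|z - k|)| ≤ |y - z| := by
  simpa using abs_abs_sub_abs_le (y - k) (z - k)

section

variable {F : Diagram} {a : EReal} {b r0 z : ℝ} {r : ℝ → ℝ → ℝ}

theorem IsEntropySolution.entropyIneq_abs {I : Set ℝ} (hr : IsEntropySolution F I r0 r)
    {k : ℝ} (hk : k ∈ Icc 0 F.rhoJam) :
    EntropyIneq I r (fun y => |y - k|) (fun y => F.flux (max y k) - F.flux (min y k)) := by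
  intro φ hφ hc hs h0
  have := hr.entropy k hk φ hφ hc hs h0
  simp_rw [Diagram.sign_mul_flux_sub] at this
  exact this

/-- Constants are weak solutions. -/
theorem integral_const_weak {I : Set ℝ} {φ : ℝ × ℝ → ℝ} (hφ : ContDiff ℝ ∞ φ)
    (hc : HasCompactSupport φ) (hs : tsupport φ ⊆ Ioi 0 ×ˢ I) (P G : ℝ) :
    ∫ p in Ioi 0 ×ˢ I, (P * fderiv ℝ φ p (1, 0) + G * fderiv ℝ φ p (0, 1)) = 0 := by
  have hall : ∀ J : Set ℝ, tsupport φ ⊆ Ioi 0 ×ˢ J →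
      ∫ p in Ioi 0 ×ˢ J, (P * fderiv ℝ φ p (1, 0) + G * fderiv ℝ φ p (0, 1)) =
        ∫ p, (P * fderiv ℝ φ p (1, 0) + G * fderiv ℝ φ p (0, 1)) := by
    refine fun J hJ => setIntegral_eq_integral_of_forall_compl_eq_zero fun p hp => ?_
    have h0 : fderiv ℝ φ p = 0 := by
      by_contra h
      exact hp (hJ (support_fderiv_subset ℝ h))
    simp [h0]
  -- the support lies to the left of some `b`
  obtain ⟨b, hb⟩ := (hc.isCompact.image continuous_snd).bddAbove
  have hb' : ∀ p ∈ tsupport φ, p.2 < b + 1 := fun p hp =>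
    (hb (mem_image_of_mem _ hp)).trans_lt (lt_add_one b)
  have hs' : tsupport φ ⊆ Ioi 0 ×ˢ incoming ⊥ (b + 1) := fun p hp =>
    ⟨(hs hp).1, EReal.bot_lt_coe _, hb' p hp⟩
  rw [hall I hs, ← hall _ hs']
  have h := integral_wave (a := ⊥) (b := b + 1) (s := 0) le_rfl hφ hc
    (hs'.trans (prod_mono_right fun x hx => hx.1)) 0 0 (fun _ => P) (fun _ => G)
  have h0 : ∀ t, φ (t, b + 1) = 0 := fun t => by
    by_contra hne
    exact lt_irrefl _ (hb' _ (subset_tsupport _ hne))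
  simpa [h0] using h

/-- Combinations of the Kruzhkov entropy and the conservation law; for `σ = 1` and `σ = -1` these
are twice the semi-entropies. -/
theorem IsEntropySolution.integral_semi (hr : IsEntropySolution F (incoming a b) r0 r)
    {k : ℝ} (hk : k ∈ Icc 0 F.rhoJam) (σ : ℝ) {φ : ℝ × ℝ → ℝ} (hφ : ContDiff ℝ ∞ φ)
    (hc : HasCompactSupport φ) (hs : tsupport φ ⊆ Ioi 0 ×ˢ incoming a b) (h0 : ∀ p, 0 ≤ φ p) :
    0 ≤ ∫ p in Ioi 0 ×ˢ incoming a b,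
      ((|r p.1 p.2 - k| + σ * (r p.1 p.2 - k)) * fderiv ℝ φ p (1, 0) +
        (F.flux (max (r p.1 p.2) k) - F.flux (min (r p.1 p.2) k)
          + σ * (F.flux (r p.1 p.2) - F.flux k)) * fderiv ℝ φ p (0, 1)) := by
  have hI := isOpen_incoming a b
  have hf := F.continuous_flux
  have hi : ∀ U G : ℝ → ℝ, Continuous U → Continuous G →
      Integrable (fun p : ℝ × ℝ => U (r p.1 p.2) * fderiv ℝ φ p (1, 0)
        + G (r p.1 p.2) * fderiv ℝ φ p (0, 1)) (volume.restrict (Ioi 0 ×ˢ incoming a b)) :=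
    fun U G hU hG => (hr.integrable_comp_mul hI hU (continuous_fderiv_apply hφ _)
      (hasCompactSupport_fderiv_apply hc _)).add
      (hr.integrable_comp_mul hI hG (continuous_fderiv_apply hφ _)
      (hasCompactSupport_fderiv_apply hc _))
  have h1 := hr.entropyIneq_abs hk φ hφ hc hs h0
  have h2 := hr.weak φ hφ hc hs
  have h3 := integral_const_weak hφ hc hs k (F.flux k)
  have i1 := hi (fun y => |y - k|) (fun y => F.flux (max y k) - F.flux (min y k))
    (by fun_prop) (by fun_prop)
  have i2 := hi (fun y => y) F.flux continuous_id hf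
  have i3 := hi (fun _ => k) (fun _ => F.flux k) continuous_const continuous_const
  have e : ∀ p : ℝ × ℝ,
      ((|r p.1 p.2 - k| + σ * (r p.1 p.2 - k)) * fderiv ℝ φ p (1, 0) +
        (F.flux (max (r p.1 p.2) k) - F.flux (min (r p.1 p.2) k)
          + σ * (F.flux (r p.1 p.2) - F.flux k)) * fderiv ℝ φ p (0, 1)) =
      (|r p.1 p.2 - k| * fderiv ℝ φ p (1, 0) +
        (F.flux (max (r p.1 p.2) k) - F.flux (min (r p.1 p.2) k)) * fderiv ℝ φ p (0, 1)) +
      σ * ((r p.1 p.2 * fderiv ℝ φ p (1, 0) + F.flux (r p.1 p.2) * fderiv ℝ φ p (0, 1))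
        - (k * fderiv ℝ φ p (1, 0) + F.flux k * fderiv ℝ φ p (0, 1))) := fun p => by ring
  simp_rw [e]
  have i4 : Integrable (fun p : ℝ × ℝ => σ *
      ((r p.1 p.2 * fderiv ℝ φ p (1, 0) + F.flux (r p.1 p.2) * fderiv ℝ φ p (0, 1))
        - (k * fderiv ℝ φ p (1, 0) + F.flux k * fderiv ℝ φ p (0, 1))))
      (volume.restrict (Ioi 0 ×ˢ incoming a b)) := (i2.sub i3).const_mul σ
  rw [integral_add i1 i4, integral_const_mul, integral_sub i2 i3, h2, h3]
  simpa using h1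

theorem IsEntropySolution.entropyIneq_max (hr : IsEntropySolution F (incoming a b) r0 r)
    {k : ℝ} (hk : k ∈ Icc 0 F.rhoJam) :
    EntropyIneq (incoming a b) r (fun y => max y k - k) (fun y => F.flux (max y k) - F.flux k) := by
  intro φ hφ hc hs h0
  have h := hr.integral_semi hk 1 hφ hc hs h0
  have e : ∀ p : ℝ × ℝ,
      ((|r p.1 p.2 - k| + 1 * (r p.1 p.2 - k)) * fderiv ℝ φ p (1, 0) +
        (F.flux (max (r p.1 p.2) k) - F.flux (min (r p.1 p.2) k)
          + 1 * (F.flux (r p.1 p.2) - F.flux k)) * fderiv ℝ φ p (0, 1)) =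
      2 * ((max (r p.1 p.2) k - k) * fderiv ℝ φ p (1, 0)
        + (F.flux (max (r p.1 p.2) k) - F.flux k) * fderiv ℝ φ p (0, 1)) := by
    intro p
    rcases le_total (r p.1 p.2) k with h | h
    · rw [max_eq_right h, min_eq_left h, abs_of_nonpos (sub_nonpos.2 h)]; ring
    · rw [max_eq_left h, min_eq_right h, abs_of_nonneg (sub_nonneg.2 h)]; ring
  simp_rw [e] at h
  rw [integral_const_mul] at h
  linarith

theorem IsEntropySolution.entropyIneq_min (hr : IsEntropySolution F (incoming a b) r0 r)
    {k : ℝ} (hk : k ∈ Icc 0 F.rhoJam) :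
    EntropyIneq (incoming a b) r (fun y => k - min y k) (fun y => F.flux k - F.flux (min y k)) := by
  intro φ hφ hc hs h0
  have h := hr.integral_semi hk (-1) hφ hc hs h0
  have e : ∀ p : ℝ × ℝ,
      ((|r p.1 p.2 - k| + -1 * (r p.1 p.2 - k)) * fderiv ℝ φ p (1, 0) +
        (F.flux (max (r p.1 p.2) k) - F.flux (min (r p.1 p.2) k)
          + -1 * (F.flux (r p.1 p.2) - F.flux k)) * fderiv ℝ φ p (0, 1)) =
      2 * ((k - min (r p.1 p.2) k) * fderiv ℝ φ p (1, 0)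
        + (F.flux k - F.flux (min (r p.1 p.2) k)) * fderiv ℝ φ p (0, 1)) := by
    intro p
    rcases le_total (r p.1 p.2) k with h | h
    · rw [max_eq_right h, min_eq_left h, abs_of_nonpos (sub_nonpos.2 h)]; ring
    · rw [max_eq_left h, min_eq_right h, abs_of_nonneg (sub_nonneg.2 h)]; ring
  simp_rw [e] at h
  rw [integral_const_mul] at h
  linarith

/-! ### Boundary values that entropy solutions can attain -/

/-- The boundary values `z` at the junction end of an incoming link that are compatible with the
initial density `r0`: all waves of the Riemann problem with left state `r0` and right state `z` have
negative speed. -/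
def IsAdmissibleTrace (F : Diagram) (r0 z : ℝ) : Prop :=
  z = r0 ∨ F.crit ≤ z ∧ (F.crit ≤ r0 ∨ F.flux z < F.flux r0)

theorem abs_flux_le (k y : ℝ) :
    F.flux (max y k) - F.flux (min y k) ≤ F.vf * |y - k| := by
  rw [← max_sub_min_eq_abs']
  exact Diagram.flux_sub_flux_le min_le_max

/-- If the Kruzhkov flux relative to the initial density does not point into the link at the
boundary value, then the initial density is never left. -/
theorem IsEntropySolution.eq_of_abs_flux_nonneg (hr : IsEntropySolution F (incoming a b) r0 r)
    (hz : ∀ᵐ t ∂(volume.restrict (Ioi 0)), Tendsto (r t) (𝓝[<] b) (𝓝 z)) (hab : a < b)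
    (hr0 : r0 ∈ Icc 0 F.rhoJam) (h : 0 ≤ F.flux (max z r0) - F.flux (min z r0)) : z = r0 := by
  have hf := F.continuous_flux
  have h1 := (hr.entropyIneq_abs hr0).eq_zero_of_boundary hr hz hab
    (fun _ _ => abs_abs_sub_sub_abs_sub_le _ _ _) (by fun_prop) (by fun_prop)
    (fun _ => abs_nonneg _) (fun _ => abs_flux_le _ _) (by simp) h
  have h2 := eq_zero_of_trace hz hab (U := fun y => |y - r0|) (by fun_prop) h1
  simpa [sub_eq_zero] using h2

theorem abs_min_sub_min_le (k y z : ℝ) : |(k - min y k) - (k - min z k)| ≤ |y - z| := by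
  rcases le_total y k with h1 | h1 <;> rcases le_total z k with h2 | h2 <;>
    simp only [min_eq_left, min_eq_right, h1, h2] <;>
    rw [abs_le] <;> constructor <;>
    linarith [le_abs_self (y - z), neg_abs_le (y - z)]

theorem abs_max_sub_max_le (k y z : ℝ) : |(max y k - k) - (max z k - k)| ≤ |y - z| := by
  rcases le_total y k with h1 | h1 <;> rcases le_total z k with h2 | h2 <;>
    simp only [max_eq_left, max_eq_right, h1, h2] <;>
    rw [abs_le] <;> constructor <;>
    linarith [le_abs_self (y - z), neg_abs_le (y - z)]

/-- A boundary value that is attained in the sense of one-sided limits is admissible. -/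
theorem IsEntropySolution.isAdmissibleTrace (hr : IsEntropySolution F (incoming a b) r0 r)
    (hz : ∀ᵐ t ∂(volume.restrict (Ioi 0)), Tendsto (r t) (𝓝[<] b) (𝓝 z)) (hab : a < b)
    (hr0 : r0 ∈ Icc 0 F.rhoJam) : IsAdmissibleTrace F r0 z := by
  have hf := F.continuous_flux
  rw [IsAdmissibleTrace, or_iff_not_imp_left]
  intro hne
  have hcrit : F.crit ≤ z := by
    by_contra hlt
    have hlt := not_le.1 hlt
    rcases le_or_gt F.crit r0 with h0 | h0
    · -- a congested initial state keeps the density above the critical one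
      have h1 := (hr.entropyIneq_min F.crit_mem).eq_zero_of_boundary hr hz hab
        (abs_min_sub_min_le _) (by fun_prop) (by fun_prop) (fun _ => by simp)
        (fun _ => Diagram.flux_sub_flux_le (min_le_right _ _)) (by simp [h0]) (by
          rw [min_eq_left hlt.le, Diagram.flux_of_le_crit le_rfl, Diagram.flux_of_le_crit hlt.le]
          nlinarith [F.vf_pos])
      have h2 := eq_zero_of_trace hz hab (U := fun y => F.crit - min y F.crit) (by fun_prop) h1
      simp only [min_eq_left hlt.le] at h2
      linarith
    · refine hne (hr.eq_of_abs_flux_nonneg hz hab hr0 ?_)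
      rw [Diagram.flux_of_le_crit (max_le hlt.le h0.le),
        Diagram.flux_of_le_crit (min_le_of_left_le hlt.le), ← mul_sub]
      exact mul_nonneg F.vf_pos.le (sub_nonneg.2 min_le_max)
  refine ⟨hcrit, ?_⟩
  by_contra hcon
  push Not at hcon
  refine hne (hr.eq_of_abs_flux_nonneg hz hab hr0 ?_)
  rw [max_eq_left (hcon.1.le.trans hcrit), min_eq_right (hcon.1.le.trans hcrit)]
  linarith [hcon.2]

/-- A negative speed `s` with which a wave can separate the states `r0` (left) and `z` (right): it
satisfies the Rankine-Hugoniot condition, and the flux lies on the correct side of the chord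
(Oleinik's entropy condition). -/
structure IsWaveSpeed (F : Diagram) (r0 z s : ℝ) : Prop where
  neg : s < 0
  jump : F.flux r0 - s * r0 = F.flux z - s * z
  chord_le : ∀ k, r0 ≤ k → k ≤ z → F.flux r0 - s * r0 ≤ F.flux k - s * k
  le_chord : ∀ k, z ≤ k → k ≤ r0 → F.flux k - s * k ≤ F.flux r0 - s * r0

/-- Every admissible boundary value is separated from the initial one by a single wave, because the
flux is linear on both branches of the triangle: a rarefaction would have to cross the critical
density. -/
theorem IsAdmissibleTrace.exists_isWaveSpeed (h : IsAdmissibleTrace F r0 z) :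
    ∃ s, IsWaveSpeed F r0 z s := by
  rcases h with rfl | ⟨hz, h⟩
  · -- there is no jump, and any speed will do
    exact ⟨-1, by norm_num, rfl, fun k h1 h2 => by rw [le_antisymm h2 h1],
      fun k h1 h2 => by rw [le_antisymm h2 h1]⟩
  by_cases h0 : F.crit ≤ r0
  · -- both states are congested: a wave with the speed of the decreasing branch
    have e : ∀ k, F.crit ≤ k → F.flux k - -F.w * k = F.w * F.rhoJam := fun k hk => by
      rw [Diagram.flux_of_crit_le hk]; ring
    refine ⟨-F.w, by linarith [F.w_pos], by rw [e _ h0, e _ hz], fun k h1 _ => ?_, fun k h1 _ => ?_⟩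
    · rw [e _ h0, e _ (h0.trans h1)]
    · rw [e _ h0, e _ (hz.trans h1)]
  · -- a shock from free flow to congestion
    have hlt : F.flux z < F.flux r0 := h.resolve_left h0
    have h0' := not_le.1 h0
    have hpos : 0 < z - r0 := by linarith
    set s := (F.flux z - F.flux r0) / (z - r0) with hs
    have hsmul : s * (z - r0) = F.flux z - F.flux r0 := by
      rw [hs, div_mul_cancel₀ _ hpos.ne']
    have hneg : s < 0 := div_neg_of_neg_of_pos (by linarith) hpos
    have hw : -F.w ≤ s := by
      rw [hs, le_div_iff₀ hpos]
      exact Diagram.le_flux_sub_flux (by linarith)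
    refine ⟨s, hneg, by linarith, fun k h1 h2 => ?_, fun k h1 h2 => by linarith⟩
    rcases le_total k F.crit with hk | hk
    · rw [Diagram.flux_of_le_crit hk, Diagram.flux_of_le_crit h0'.le]
      nlinarith [F.vf_pos]
    · have : F.flux z - s * z ≤ F.flux k - s * k := by
        rw [Diagram.flux_of_crit_le hk, Diagram.flux_of_crit_le hz]
        nlinarith
      linarith

/-- Among the admissible boundary values, the flow determines the density. -/
theorem IsAdmissibleTrace.eq_of_flux_eq {z' : ℝ} (h : IsAdmissibleTrace F r0 z)
    (h' : IsAdmissibleTrace F r0 z') (he : F.flux z = F.flux z') : z = z' := by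
  have key : ∀ {y y' : ℝ}, F.crit ≤ y → F.crit ≤ y' → F.flux y = F.flux y' → y = y' := by
    intro y y' hy hy' he
    rw [Diagram.flux_of_crit_le hy, Diagram.flux_of_crit_le hy'] at he
    have := mul_left_cancel₀ F.w_pos.ne' he
    linarith
  rcases h with rfl | ⟨hz, h⟩
  · rcases h' with h' | ⟨hz', h'⟩
    · exact h'.symm
    · rcases h' with h' | h'
      · exact key h' hz' he
      · exact absurd he h'.ne'
  · rcases h' with rfl | ⟨hz', -⟩
    · rcases h with h | h
      · exact key hz h he
      · exact absurd he h.ne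
    · exact key hz hz' he

theorem IsAdmissibleTrace.flux_le (h : IsAdmissibleTrace F r0 z) (h0 : r0 ≤ F.crit) :
    F.flux z ≤ F.flux r0 := by
  rcases h with rfl | ⟨hz, h⟩
  · exact le_rfl
  · rcases h with h | h
    · have : r0 = F.crit := le_antisymm h0 h
      rw [this, Diagram.flux_of_crit_le hz, Diagram.flux_of_crit_le le_rfl]
      exact mul_le_mul_of_nonneg_left (by linarith) F.w_pos.le
    · exact h.le

/-! ### Uniqueness on a link -/

theorem volume_wall (b s : ℝ) : volume {p : ℝ × ℝ | p.2 = b + s * p.1} = 0 := by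
  have hm : MeasurableSet {p : ℝ × ℝ | p.2 = b + s * p.1} :=
    (isClosed_eq (by fun_prop) (by fun_prop)).measurableSet
  rw [Measure.volume_eq_prod, Measure.measure_prod_null hm]
  refine Eventually.of_forall fun t => ?_
  have : Prod.mk t ⁻¹' {p : ℝ × ℝ | p.2 = b + s * p.1} = {b + s * t} := by
    ext x; simp
  simp [this]

/-- An entropy solution that attains its boundary value is a single wave, where no wave from the
far end can have arrived. -/
theorem IsEntropySolution.eq_wave (hr : IsEntropySolution F (incoming a b) r0 r)
    (hz : ∀ᵐ t ∂(volume.restrict (Ioi 0)), Tendsto (r t) (𝓝[<] b) (𝓝 z)) (hab : a < b)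
    (hr0 : r0 ∈ Icc 0 F.rhoJam) (hzI : z ∈ Icc 0 F.rhoJam) {s : ℝ} (hs : IsWaveSpeed F r0 z s) :
    ∀ᵐ p ∂(volume.restrict (Ioi 0 ×ˢ incoming a b)), a < ((p.2 - F.vf * p.1 : ℝ) : EReal) →
      r p.1 p.2 = wave b s r0 z p.1 p.2 := by
  have hf := F.continuous_flux
  -- the density stays between the initial and the boundary value
  have hmax := (hr.entropyIneq_max (k := max r0 z)
    ⟨hr0.1.trans (le_max_left _ _), max_le hr0.2 hzI.2⟩).eq_zero_of_boundary hr hz hab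
    (abs_max_sub_max_le _) (by fun_prop) (by fun_prop) (fun _ => by simp)
    (fun _ => Diagram.flux_sub_flux_le (le_max_right _ _)) (by simp) (by simp)
  have hmin := (hr.entropyIneq_min (k := min r0 z)
    ⟨le_min hr0.1 hzI.1, (min_le_left _ _).trans hr0.2⟩).eq_zero_of_boundary hr hz hab
    (abs_min_sub_min_le _) (by fun_prop) (by fun_prop) (fun _ => by simp)
    (fun _ => Diagram.flux_sub_flux_le (min_le_right _ _)) (by simp) (by simp)
  -- ahead of the wave, which moves away from the junction, the initial state persists
  have hleft := (hr.entropyIneq_abs hr0).eq_zero hr hz hab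
    (fun _ _ => abs_abs_sub_sub_abs_sub_le _ _ _) (by fun_prop) (by fun_prop)
    (fun _ => abs_nonneg _) (fun _ => abs_flux_le _ _) s
    (ψ := fun y => Real.smoothTransition (-y))
    (contDiff_smoothTransition.comp contDiff_neg) (fun _ => Real.smoothTransition.nonneg _)
    (fun y _ => by simp) (fun t ht => by
      rw [neg_neg, Real.smoothTransition.zero_of_nonpos (by nlinarith [hs.neg]), mul_zero]) (by
      filter_upwards [hmax, hmin] with p h1 h2 h3
      have h1 := h1 h3
      have h2 := h2 h3
      rw [deriv_comp_neg]
      refine mul_nonpos_of_nonpos_of_nonneg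
        (neg_nonpos.2 (deriv_smoothTransition_nonneg _)) ?_
      have h4 : r p.1 p.2 ≤ max r0 z := by simpa [sub_eq_zero] using h1
      have h5 : min r0 z ≤ r p.1 p.2 := by
        rw [sub_eq_zero] at h2
        exact min_eq_right_iff.1 h2.symm
      rcases le_total r0 (r p.1 p.2) with h | h
      · rw [max_eq_left h, min_eq_right h, abs_of_nonneg (sub_nonneg.2 h)]
        rcases le_max_iff.1 h4 with h6 | h6
        · simp [le_antisymm h6 h]
        · linarith [hs.chord_le _ h h6]
      · rw [max_eq_right h, min_eq_left h, abs_of_nonpos (sub_nonpos.2 h)]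
        rcases min_le_iff.1 h5 with h6 | h6
        · simp [le_antisymm h h6]
        · linarith [hs.le_chord _ h6 h])
  -- behind the wave no entropy relative to `z` enters, not even from the initial line, which the
  -- region to the right of the wall does not touch
  have hright := (hr.entropyIneq_abs hzI).eq_zero hr hz hab
    (fun _ _ => abs_abs_sub_sub_abs_sub_le _ _ _) (by fun_prop) (by fun_prop)
    (fun _ => abs_nonneg _) (fun _ => abs_flux_le _ _) s (ψ := Real.smoothTransition)
    contDiff_smoothTransition Real.smoothTransition.nonneg
    (fun y hy => by rw [Real.smoothTransition.zero_of_nonpos hy.le, mul_zero])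
    (fun t ht => by simp) (by
      filter_upwards [hmax, hmin] with p h1 h2 h3
      have h1 := h1 h3
      have h2 := h2 h3
      refine mul_nonpos_of_nonneg_of_nonpos (deriv_smoothTransition_nonneg _) ?_
      have h4 : r p.1 p.2 ≤ max r0 z := by simpa [sub_eq_zero] using h1
      have h5 : min r0 z ≤ r p.1 p.2 := by
        rw [sub_eq_zero] at h2
        exact min_eq_right_iff.1 h2.symm
      have hj := hs.jump
      rcases le_total z (r p.1 p.2) with h | h
      · rw [max_eq_left h, min_eq_right h, abs_of_nonneg (sub_nonneg.2 h)]
        rcases le_max_iff.1 h4 with h6 | h6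
        · linarith [hs.le_chord _ h h6]
        · simp [le_antisymm h6 h]
      · rw [max_eq_right h, min_eq_left h, abs_of_nonpos (sub_nonpos.2 h)]
        rcases min_le_iff.1 h5 with h6 | h6
        · linarith [hs.chord_le _ h6 h]
        · simp [le_antisymm h h6])
  have hwall : ∀ᵐ p : ℝ × ℝ ∂(volume.restrict (Ioi 0 ×ˢ incoming a b)), p.2 ≠ b + s * p.1 :=
    ae_restrict_of_ae (ae_iff.2 (by simpa using volume_wall b s))
  filter_upwards [hleft, hright, hwall] with p h1 h2 h3 h4
  rw [wave]
  split_ifs with h5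
  · have := h1 h4 (Real.smoothTransition.pos_of_pos (by linarith))
    simpa [sub_eq_zero] using this
  · have h6 : b + s * p.1 < p.2 := lt_of_le_of_ne (not_lt.1 h5) (Ne.symm h3)
    have := h2 h4 (Real.smoothTransition.pos_of_pos (by linarith))
    simpa [sub_eq_zero] using this

end

/-! ### Existence on a link -/

section

variable {F : Diagram} {b r0 z s : ℝ}

theorem wave_mem {S : Set ℝ} (hr0 : r0 ∈ S) (hz : z ∈ S) (t x : ℝ) : wave b s r0 z t x ∈ S := by
  unfold wave
  split_ifs <;> assumption

theorem measurable_wave : Measurable (Function.uncurry (wave b s r0 z)) := by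
  refine Measurable.ite ?_ measurable_const measurable_const
  exact (isOpen_lt continuous_snd (by fun_prop :
    Continuous fun p : ℝ × ℝ => b + s * p.1)).measurableSet

theorem tendsto_integral_wave (t₀ : ℝ) {K : Set ℝ} (hK : IsCompact K) (l : Filter ℝ) (hl : l ≤ 𝓝 t₀)
    [l.IsCountablyGenerated] :
    Tendsto (fun t => ∫ x in K, |wave b s r0 z t x - wave b s r0 z t₀ x|) l (𝓝 0) := by
  have hm : ∀ t, Measurable (wave b s r0 z t) := fun t =>
    measurable_wave.comp measurable_prodMk_left
  rw [show (0 : ℝ) = ∫ x in K, (0 : ℝ) by simp]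
  refine tendsto_integral_filter_of_dominated_convergence (fun _ => |r0 - z|)
    (Eventually.of_forall fun t => ((hm t).sub (hm t₀)).abs.aestronglyMeasurable)
    (Eventually.of_forall fun t => Eventually.of_forall fun x => ?_)
    (integrableOn_const hK.measure_lt_top.ne) ?_
  · rw [Real.norm_eq_abs, abs_abs]
    unfold wave
    split_ifs
    · simp
    · exact le_rfl
    · exact (abs_sub_comm z r0).le
    · simp
  · have hne : ∀ᵐ x ∂(volume.restrict K), x ≠ b + s * t₀ :=
      ae_restrict_of_ae (ae_iff.2 (by simp))
    filter_upwards [hne] with x hx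
    refine tendsto_const_nhds.congr' ?_
    have hc : Tendsto (fun t => b + s * t) l (𝓝 (b + s * t₀)) :=
      ((by fun_prop : Continuous fun t : ℝ => b + s * t).tendsto t₀).mono_left hl
    rcases lt_or_gt_of_ne hx with h | h
    · filter_upwards [hc.eventually_const_lt h] with t ht
      simp [wave, h, ht]
    · filter_upwards [hc.eventually_lt_const h] with t ht
      simp [wave, h.le.not_gt, ht.le.not_gt]

/-- A single wave of admissible speed is an entropy solution. -/
theorem IsWaveSpeed.isEntropySolution (a : EReal) (b : ℝ) (hs : IsWaveSpeed F r0 z s)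
    (hr0 : r0 ∈ Icc 0 F.rhoJam) (hz : z ∈ Icc 0 F.rhoJam) :
    IsEntropySolution F (incoming a b) r0 (wave b s r0 z) where
  mem_range t _ x _ := wave_mem hr0 hz t x
  measurable := measurable_wave.aestronglyMeasurable
  measurable_slice t _ := (measurable_wave.comp measurable_prodMk_left).aestronglyMeasurable
  continuous t₀ _ K hK _ := tendsto_integral_wave t₀ hK _ nhdsWithin_le_nhds
  initial := by
    filter_upwards [ae_restrict_mem (isOpen_incoming a b).measurableSet] with x hx
    simp [wave, hx.2]
  weak φ hφ hc hsupp := by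
    have h0 : ∀ t, φ (t, b) = 0 := fun t => by
      by_contra hne
      exact lt_irrefl b (hsupp (subset_tsupport _ hne)).2.2
    have := integral_wave (a := a) (b := b) hs.neg.le hφ hc
      (hsupp.trans (prod_mono_right fun x hx => hx.1)) r0 z id F.flux
    simpa [h0, hs.jump] using this
  entropy k _ φ hφ hc hsupp hφ0 := by
    have h0 : ∀ t, φ (t, b) = 0 := fun t => by
      by_contra hne
      exact lt_irrefl b (hsupp (subset_tsupport _ hne)).2.2
    rw [integral_wave (a := a) (b := b) hs.neg.le hφ hc
      (hsupp.trans (prod_mono_right fun x hx => hx.1)) r0 z (fun y => |y - k|)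
      (fun y => Real.sign (y - k) * (F.flux y - F.flux k))]
    simp only [h0, integral_zero, mul_zero, zero_add]
    refine mul_nonneg ?_ (integral_nonneg fun t => hφ0 _)
    rw [Diagram.sign_mul_flux_sub, Diagram.sign_mul_flux_sub]
    have hj := hs.jump
    rcases le_total r0 k with h1 | h1 <;> rcases le_total z k with h2 | h2
    · rw [max_eq_right h1, min_eq_left h1, max_eq_right h2, min_eq_left h2,
        abs_of_nonpos (sub_nonpos.2 h1), abs_of_nonpos (sub_nonpos.2 h2)]
      linarith
    · rw [max_eq_right h1, min_eq_left h1, max_eq_left h2, min_eq_right h2,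
        abs_of_nonpos (sub_nonpos.2 h1), abs_of_nonneg (sub_nonneg.2 h2)]
      linarith [hs.chord_le k h1 h2]
    · rw [max_eq_left h1, min_eq_right h1, max_eq_right h2, min_eq_left h2,
        abs_of_nonneg (sub_nonneg.2 h1), abs_of_nonpos (sub_nonpos.2 h2)]
      linarith [hs.le_chord k h2 h1]
    · rw [max_eq_left h1, min_eq_right h1, max_eq_left h2, min_eq_right h2,
        abs_of_nonneg (sub_nonneg.2 h1), abs_of_nonneg (sub_nonneg.2 h2)]
      linarith

theorem tendsto_wave (hs : s < 0) {t : ℝ} (ht : 0 < t) :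
    Tendsto (wave b s r0 z t) (𝓝[<] b) (𝓝 z) := by
  refine tendsto_const_nhds.congr' ?_
  have : b + s * t < b := by nlinarith
  filter_upwards [nhdsWithin_le_nhds (Ioi_mem_nhds this)] with x hx
  have hx' : b + s * t < x := hx
  simp [wave, hx'.le.not_gt]

theorem boundedVariationOn_wave (t : ℝ) (I : Set ℝ) :
    BoundedVariationOn (wave b s r0 z t) I := by
  have hm : Monotone (wave b s 0 1 t) := by
    intro x y hxy
    unfold wave
    split_ifs <;> first | exact le_rfl | exact zero_le_one | linarith
  have h1 : BoundedVariationOn (wave b s 0 1 t) I :=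
    (hm.monotoneOn I).boundedVariationOn (C := 1) fun x _ =>
      wave_mem (S := {y | |y| ≤ 1}) (by simp) (by simp) t x
  have hL : LipschitzWith ‖z - r0‖₊ fun y : ℝ => r0 + (z - r0) * y := by
    refine LipschitzWith.of_dist_le_mul fun x y => ?_
    rw [Real.dist_eq, Real.dist_eq, coe_nnnorm, Real.norm_eq_abs, ← abs_mul]
    exact le_of_eq (congrArg _ (by ring))
  have h2 := hL.comp_boundedVariationOn h1
  convert h2 using 1
  funext x
  simp only [wave, Function.comp_apply]
  split_ifs <;> ring

end

/-! ### Reflection -/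

/-- The fundamental diagram of the spaces between the vehicles: the density is `rhoJam - r`, and
the direction of the link is reversed. -/
def Diagram.reflect (F : Diagram) : Diagram where
  vf := F.w
  w := F.vf
  rhoJam := F.rhoJam
  vf_pos := F.w_pos
  w_pos := F.vf_pos
  rhoJam_pos := F.rhoJam_pos

/-- The density of the spaces between the vehicles, with the direction of the link reversed. -/
def reflectDensity (c : ℝ) (r : ℝ → ℝ → ℝ) (t x : ℝ) : ℝ := c - r t (-x)

namespace Diagram

variable (F : Diagram)

theorem reflect_flux (y : ℝ) : F.reflect.flux y = F.flux (F.rhoJam - y) := by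
  simp only [flux, reflect, sub_sub_cancel]
  exact min_comm _ _

theorem reflect_flux_sub (y : ℝ) : F.reflect.flux (F.rhoJam - y) = F.flux y := by
  rw [reflect_flux, sub_sub_cancel]

end Diagram

/-- The reflection `(t, x) ↦ (t, -x)`. -/
def reflectSpace : ℝ × ℝ ≃ₜ ℝ × ℝ := (Homeomorph.refl ℝ).prodCongr (Homeomorph.neg ℝ)

theorem reflectSpace_apply (p : ℝ × ℝ) : reflectSpace p = (p.1, -p.2) := rfl

theorem measurePreserving_reflectSpace : MeasurePreserving reflectSpace :=
  (MeasurePreserving.id volume).prod (Measure.measurePreserving_neg volume)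

theorem reflectSpace_preimage (I : Set ℝ) :
    reflectSpace ⁻¹' (Ioi 0 ×ˢ I) = Ioi 0 ×ˢ (Neg.neg ⁻¹' I) := rfl

theorem setIntegral_reflect (I : Set ℝ) (f : ℝ × ℝ → ℝ) :
    ∫ p in Ioi 0 ×ˢ (Neg.neg ⁻¹' I), f p = ∫ p in Ioi 0 ×ˢ I, f (p.1, -p.2) := by
  rw [← reflectSpace_preimage, ← measurePreserving_reflectSpace.setIntegral_preimage_emb
    reflectSpace.measurableEmbedding (fun p => f (p.1, -p.2))]
  simp [reflectSpace_apply]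

theorem contDiff_reflect {φ : ℝ × ℝ → ℝ} (hφ : ContDiff ℝ ∞ φ) :
    ContDiff ℝ ∞ (φ ∘ reflectSpace) :=
  hφ.comp (contDiff_fst.prodMk contDiff_snd.neg)

theorem fderiv_reflect_time {φ : ℝ × ℝ → ℝ} (hφ : ContDiff ℝ ∞ φ) (p : ℝ × ℝ) :
    fderiv ℝ (φ ∘ reflectSpace) p (1, 0) = fderiv ℝ φ (p.1, -p.2) (1, 0) := by
  exact (hasDerivAt_fderiv_time (contDiff_reflect hφ) p.1 p.2).unique
    (hasDerivAt_fderiv_time hφ p.1 (-p.2))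

theorem fderiv_reflect_space {φ : ℝ × ℝ → ℝ} (hφ : ContDiff ℝ ∞ φ) (p : ℝ × ℝ) :
    fderiv ℝ (φ ∘ reflectSpace) p (0, 1) = -fderiv ℝ φ (p.1, -p.2) (0, 1) := by
  refine (hasDerivAt_fderiv_space (contDiff_reflect hφ) p.1 p.2).unique ?_
  have := (hasDerivAt_fderiv_space hφ p.1 (-p.2)).scomp p.2 (hasDerivAt_neg p.2)
  rw [neg_one_smul] at this
  exact this

theorem tsupport_reflect {φ : ℝ × ℝ → ℝ} {I : Set ℝ}
    (hs : tsupport φ ⊆ Ioi 0 ×ˢ (Neg.neg ⁻¹' I)) :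
    tsupport (φ ∘ reflectSpace) ⊆ Ioi 0 ×ˢ I := by
  intro p hp
  have h1 : reflectSpace p ∈ tsupport φ :=
    tsupport_comp_subset_preimage φ reflectSpace.continuous hp
  have h2 := hs h1
  refine ⟨h2.1, ?_⟩
  simpa [reflectSpace_apply] using h2.2

/-- Reflection turns entropy solutions into entropy solutions. -/
theorem IsEntropySolution.reflect {F : Diagram} {I : Set ℝ} {r0 : ℝ} {r : ℝ → ℝ → ℝ}
    (hr : IsEntropySolution F I r0 r) (hI : IsOpen I) :
    IsEntropySolution F.reflect (Neg.neg ⁻¹' I) (F.rhoJam - r0) (reflectDensity F.rhoJam r) where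
  mem_range t ht x hx := by
    have := hr.mem_range t ht (-x) hx
    exact ⟨sub_nonneg.2 this.2, sub_le_self _ this.1⟩
  measurable := by
    have h := hr.measurable.comp_measurePreserving
      (measurePreserving_reflectSpace.restrict_preimage (measurableSet_Ioi.prod hI.measurableSet))
    exact aestronglyMeasurable_const.sub h
  measurable_slice t ht := by
    have h := (hr.measurable_slice t ht).comp_measurePreserving
      ((Measure.measurePreserving_neg volume).restrict_preimage hI.measurableSet)
    exact aestronglyMeasurable_const.sub h
  continuous t₀ ht₀ K hK hKI := by
    have hK' : IsCompact (Neg.neg ⁻¹' K) := (Homeomorph.neg ℝ).isCompact_preimage.2 hK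
    have h := hr.continuous t₀ ht₀ (Neg.neg ⁻¹' K) hK' fun x hx => by
      simpa using hKI hx
    refine h.congr fun t => ?_
    rw [← (Measure.measurePreserving_neg volume).setIntegral_preimage_emb
      (Homeomorph.neg ℝ).measurableEmbedding]
    have : (Neg.neg ⁻¹' (Neg.neg ⁻¹' K) : Set ℝ) = K := by ext x; simp
    rw [this]
    refine integral_congr_ae (Eventually.of_forall fun x => ?_)
    simp only [reflectDensity, sub_sub_sub_cancel_left]
    exact abs_sub_comm _ _
  initial := by
    have h := ((Measure.measurePreserving_neg volume).restrict_preimage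
      hI.measurableSet).quasiMeasurePreserving.ae hr.initial
    filter_upwards [h] with x hx
    rw [reflectDensity, hx]
  weak φ hφ hc hs := by
    have hc' := hc.comp_homeomorph reflectSpace
    have hφ' := contDiff_reflect hφ
    have hs' := tsupport_reflect hs
    have h1 := hr.weak _ hφ' hc' hs'
    have h2 := integral_const_weak hφ' hc' hs' F.rhoJam 0
    rw [setIntegral_reflect]
    have i1 := (hr.integrable_comp_mul hI (U := fun y => y) continuous_id
      (continuous_fderiv_apply hφ' (1, 0)) (hasCompactSupport_fderiv_apply hc' _)).add
      (hr.integrable_comp_mul hI F.continuous_flux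
      (continuous_fderiv_apply hφ' (0, 1)) (hasCompactSupport_fderiv_apply hc' _))
    have i2 := (hr.integrable_comp_mul hI (U := fun _ => F.rhoJam) continuous_const
      (continuous_fderiv_apply hφ' (1, 0)) (hasCompactSupport_fderiv_apply hc' _)).add
      (hr.integrable_comp_mul hI (U := fun _ => 0) continuous_const
      (continuous_fderiv_apply hφ' (0, 1)) (hasCompactSupport_fderiv_apply hc' _))
    have h3 := integral_sub i2 i1
    simp only [Pi.add_apply] at h3
    rw [h1, h2, sub_zero] at h3
    refine Eq.trans ?_ h3
    refine integral_congr_ae (Eventually.of_forall fun p => ?_)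
    simp only [reflectDensity, neg_neg, Diagram.reflect_flux_sub, fderiv_reflect_time hφ,
      fderiv_reflect_space hφ]
    ring
  entropy k hk φ hφ hc hs h0 := by
    have hk' : F.rhoJam - k ∈ Icc 0 F.rhoJam := ⟨sub_nonneg.2 hk.2, sub_le_self _ hk.1⟩
    have h := hr.entropy (F.rhoJam - k) hk' _ (contDiff_reflect hφ)
      (hc.comp_homeomorph reflectSpace) (tsupport_reflect hs) fun p => h0 _
    rw [setIntegral_reflect]
    refine h.trans_eq (integral_congr_ae (Eventually.of_forall fun p => ?_))
    have e : F.rhoJam - r p.1 p.2 - k = -(r p.1 p.2 - (F.rhoJam - k)) := by ring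
    simp only [reflectDensity, neg_neg, Diagram.reflect_flux_sub, fderiv_reflect_time hφ,
      fderiv_reflect_space hφ, e, abs_neg, Real.sign_neg, F.reflect_flux k]
    ring

/-! ### The links of a junction -/

namespace Junction

variable {n : ℕ} (J : Junction n)

theorem link_zero : J.link 0 = incoming (J.far 0) (J.node 0) := rfl

theorem link_succ (i : Fin n) :
    J.link i.succ = Neg.neg ⁻¹' incoming (-J.far i.succ) (-J.node i.succ) := by
  ext x
  simp only [link, Fin.succ_ne_zero, if_false, incoming, mem_preimage, mem_ofPred_eq,
    neg_lt_neg_iff, EReal.coe_neg, EReal.neg_lt_neg_iff]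
  exact and_comm

theorem isOpen_link (l : Fin (n + 1)) : IsOpen (J.link l) := by
  refine Fin.cases (isOpen_incoming _ _) (fun i => ?_) l
  rw [link_succ]
  exact (isOpen_incoming _ _).preimage continuous_neg

theorem neg_preimage_link_succ (i : Fin n) :
    Neg.neg ⁻¹' J.link i.succ = incoming (-J.far i.succ) (-J.node i.succ) := by
  rw [link_succ]
  ext x
  simp

theorem side_succ (i : Fin n) : J.side i.succ = 𝓝[>] (J.node i.succ) := by
  simp [side]

instance side_neBot (l : Fin (n + 1)) : (J.side l).NeBot := by
  unfold side
  split_ifs <;> infer_instance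

theorem measurableSet_determined (l : Fin (n + 1)) : MeasurableSet (J.determined l) := by
  have h1 : IsOpen {p : ℝ × ℝ | 0 < p.1} := isOpen_lt continuous_const continuous_fst
  have h2 : IsOpen {p : ℝ × ℝ | p.2 ∈ J.link l} := (J.isOpen_link l).preimage continuous_snd
  have h3 : IsOpen {p : ℝ × ℝ | J.far l < ((p.2 - (J.diag l).vf * p.1 : ℝ) : EReal)} :=
    isOpen_lt continuous_const (continuous_coe_real_ereal.comp (by fun_prop))
  have h4 : IsOpen {p : ℝ × ℝ | ((p.2 + (J.diag l).w * p.1 : ℝ) : EReal) < J.far l} :=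
    isOpen_lt (continuous_coe_real_ereal.comp (by fun_prop)) continuous_const
  unfold determined
  split_ifs
  · subst l; exact (h1.inter (h2.inter h3)).measurableSet
  · exact (h1.inter (h2.inter h4)).measurableSet

theorem determined_subset (l : Fin (n + 1)) : J.determined l ⊆ Ioi 0 ×ˢ J.link l :=
  fun _ hp => ⟨hp.1, hp.2.1⟩

/-- The boundary densities `z` at the junction that are compatible with the initial density `r0` of
link `l`. Outgoing links are treated as reflected incoming links. -/
def IsCompatible (l : Fin (n + 1)) (r0 z : ℝ) : Prop :=
  if l = 0 then IsAdmissibleTrace (J.diag l) r0 z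
  else IsAdmissibleTrace (J.diag l).reflect ((J.diag l).rhoJam - r0) ((J.diag l).rhoJam - z)

theorem isCompatible_zero {r0 z : ℝ} :
    J.IsCompatible 0 r0 z ↔ IsAdmissibleTrace (J.diag 0) r0 z := by
  simp [IsCompatible]

theorem isCompatible_succ {i : Fin n} {r0 z : ℝ} : J.IsCompatible i.succ r0 z ↔
    IsAdmissibleTrace (J.diag i.succ).reflect ((J.diag i.succ).rhoJam - r0)
      ((J.diag i.succ).rhoJam - z) := by
  simp [IsCompatible]

/-- The solution of the initial-boundary value problem on link `l` with initial density `r0` and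
boundary density `z`, together with its balance up to the junction. -/
structure IsLinkSolution (l : Fin (n + 1)) (r0 z : ℝ) (v : ℝ → ℝ → ℝ) : Prop where
  entropySolution : IsEntropySolution (J.diag l) (J.link l) r0 v
  trace : ∀ t, 0 < t → Tendsto (v t) (J.side l) (𝓝 z)
  boundedVariation : ∀ t, BoundedVariationOn (v t) (J.link l)
  balance : ∀ φ : ℝ × ℝ → ℝ, ContDiff ℝ ∞ φ → HasCompactSupport φ →
    tsupport φ ⊆ Ioi 0 ×ˢ J.nearSide l →
    ∫ p in Ioi 0 ×ˢ J.link l, (v p.1 p.2 * fderiv ℝ φ p (1, 0)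
      + (J.diag l).flux (v p.1 p.2) * fderiv ℝ φ p (0, 1)) =
    (if l = 0 then 1 else -1) * (J.diag l).flux z * ∫ t in Ioi 0, φ (t, J.node l)
  unique : ∀ r : ℝ → ℝ → ℝ, IsEntropySolution (J.diag l) (J.link l) r0 r →
    (∀ᵐ t ∂(volume.restrict (Ioi 0)), Tendsto (r t) (J.side l) (𝓝 z)) →
    Function.uncurry r =ᵐ[volume.restrict (J.determined l)] Function.uncurry v

end Junction

theorem tendsto_reflectDensity {r : ℝ → ℝ → ℝ} {t a z c : ℝ}
    (h : Tendsto (r t) (𝓝[>] a) (𝓝 z)) :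
    Tendsto (reflectDensity c r t) (𝓝[<] (-a)) (𝓝 (c - z)) :=
  (h.comp tendsto_neg_nhdsLT_neg).const_sub c

theorem tendsto_reflectDensity' {r : ℝ → ℝ → ℝ} {t a z c : ℝ}
    (h : Tendsto (r t) (𝓝[<] (-a)) (𝓝 z)) :
    Tendsto (reflectDensity c r t) (𝓝[>] a) (𝓝 (c - z)) :=
  (h.comp tendsto_neg_nhdsGT).const_sub c

theorem boundedVariationOn_reflectDensity {r : ℝ → ℝ → ℝ} {t : ℝ} (c : ℝ) {I : Set ℝ}
    (h : BoundedVariationOn (r t) (Neg.neg '' I)) :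
    BoundedVariationOn (reflectDensity c r t) I := by
  have h1 : BoundedVariationOn (r t ∘ Neg.neg) I := by
    rw [BoundedVariationOn, eVariationOn.comp_eq_of_antitoneOn (r t) Neg.neg
      fun _ _ _ _ hxy => neg_le_neg hxy]
    exact h
  have hL : LipschitzWith 1 fun y : ℝ => c - y := by
    refine LipschitzWith.of_dist_le_mul fun x y => ?_
    rw [dist_sub_left, NNReal.coe_one, one_mul]
  exact hL.comp_boundedVariationOn h1

namespace Junction

variable {n : ℕ} (J : Junction n)

theorem far_lt_neg_node (i : Fin n) : -J.far i.succ < ((-J.node i.succ : ℝ) : EReal) := by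
  rw [EReal.coe_neg, EReal.neg_lt_neg_iff]
  exact J.lt_far i

theorem reflect_succ {i : Fin n} {r0 : ℝ} {r : ℝ → ℝ → ℝ}
    (hr : IsEntropySolution (J.diag i.succ) (J.link i.succ) r0 r) :
    IsEntropySolution (J.diag i.succ).reflect (incoming (-J.far i.succ) (-J.node i.succ))
      ((J.diag i.succ).rhoJam - r0) (reflectDensity (J.diag i.succ).rhoJam r) := by
  have := hr.reflect (J.isOpen_link _)
  rwa [neg_preimage_link_succ] at this

/-- The boundary densities that a solution attains are compatible with the initial state. -/
theorem isCompatible_of_trace {l : Fin (n + 1)} {r0 z : ℝ} {r : ℝ → ℝ → ℝ}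
    (hr0 : r0 ∈ Icc 0 (J.diag l).rhoJam)
    (hr : IsEntropySolution (J.diag l) (J.link l) r0 r)
    (hz : ∀ᵐ t ∂(volume.restrict (Ioi 0)), Tendsto (r t) (J.side l) (𝓝 z)) :
    J.IsCompatible l r0 z := by
  induction l using Fin.cases with
  | zero => exact J.isCompatible_zero.2 (hr.isAdmissibleTrace hz J.far_lt hr0)
  | succ i =>
    rw [isCompatible_succ]
    refine (J.reflect_succ hr).isAdmissibleTrace (hz.mono fun t ht => ?_) (J.far_lt_neg_node i)
      ⟨sub_nonneg.2 hr0.2, sub_le_self _ hr0.1⟩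
    rw [side_succ] at ht
    exact tendsto_reflectDensity ht

theorem exists_isLinkSolution_zero {r0 z : ℝ} (hr0 : r0 ∈ Icc 0 (J.diag 0).rhoJam)
    (hz : z ∈ Icc 0 (J.diag 0).rhoJam) (h : J.IsCompatible 0 r0 z) :
    ∃ v, J.IsLinkSolution 0 r0 z v := by
  obtain ⟨s, hs⟩ := (J.isCompatible_zero.1 h).exists_isWaveSpeed
  refine ⟨wave (J.node 0) s r0 z, hs.isEntropySolution _ _ hr0 hz,
    fun t ht => tendsto_wave hs.neg ht, fun t => boundedVariationOn_wave t _,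
    fun φ hφ hc hsupp => ?_, fun r hr htr => ?_⟩
  · have := integral_wave (b := J.node 0) hs.neg.le hφ hc hsupp r0 z id (J.diag 0).flux
    rw [link_zero]
    simpa [hs.jump] using this
  · have h1 := hr.eq_wave htr J.far_lt hr0 hz hs
    have h2 := ae_restrict_of_ae_restrict_of_subset (J.determined_subset 0) h1
    filter_upwards [h2, ae_restrict_mem (J.measurableSet_determined 0)] with p h3 hp
    exact h3 hp.2.2

theorem exists_isLinkSolution_succ {i : Fin n} {r0 z : ℝ}
    (hr0 : r0 ∈ Icc 0 (J.diag i.succ).rhoJam) (hz : z ∈ Icc 0 (J.diag i.succ).rhoJam)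
    (h : J.IsCompatible i.succ r0 z) : ∃ v, J.IsLinkSolution i.succ r0 z v := by
  obtain ⟨s, hs⟩ := (J.isCompatible_succ.1 h).exists_isWaveSpeed
  set F := J.diag i.succ with hF
  have hr0' : F.rhoJam - r0 ∈ Icc 0 F.reflect.rhoJam :=
    ⟨sub_nonneg.2 hr0.2, sub_le_self _ hr0.1⟩
  have hz' : F.rhoJam - z ∈ Icc 0 F.reflect.rhoJam := ⟨sub_nonneg.2 hz.2, sub_le_self _ hz.1⟩
  set u := wave (-J.node i.succ) s (F.rhoJam - r0) (F.rhoJam - z) with hu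
  have hIm := (isOpen_incoming (-J.far i.succ) (-J.node i.succ))
  refine ⟨reflectDensity F.rhoJam u, ?_, fun t ht => ?_, fun t => ?_,
    fun φ hφ hc hsupp => ?_, fun r hr htr => ?_⟩
  · have h1 := (hs.isEntropySolution (-J.far i.succ) (-J.node i.succ) hr0' hz').reflect hIm
    rw [← link_succ] at h1
    have h2 : F.reflect.rhoJam - (F.rhoJam - r0) = r0 := sub_sub_cancel _ _
    rw [h2] at h1
    exact h1
  · rw [side_succ]
    have := tendsto_reflectDensity' (c := F.rhoJam) (tendsto_wave (b := -J.node i.succ)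
      (r0 := F.rhoJam - r0) (z := F.rhoJam - z) hs.neg ht)
    rwa [sub_sub_cancel] at this
  · exact boundedVariationOn_reflectDensity _ (boundedVariationOn_wave t _)
  · have hsupp' : tsupport (φ ∘ reflectSpace) ⊆ Ioi 0 ×ˢ {x : ℝ | -J.far i.succ < x} := by
      refine tsupport_reflect (hsupp.trans (prod_mono_right fun x hx => ?_))
      have hx' : (x : EReal) < J.far i.succ := by simpa [nearSide] using hx
      simpa only [mem_preimage, mem_ofPred_eq, EReal.coe_neg, EReal.neg_lt_neg_iff] using hx'
    have h1 := integral_wave (b := -J.node i.succ) hs.neg.le (contDiff_reflect hφ)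
      (hc.comp_homeomorph reflectSpace) hsupp' (F.rhoJam - r0) (F.rhoJam - z)
      (fun y => F.rhoJam - y) (fun y => -F.reflect.flux y)
    have hj := hs.jump
    have h2 : (-F.reflect.flux (F.rhoJam - r0) - s * (F.rhoJam - (F.rhoJam - r0))) -
        (-F.reflect.flux (F.rhoJam - z) - s * (F.rhoJam - (F.rhoJam - z))) = 0 := by
      linarith
    rw [h2, zero_mul, add_zero, Diagram.reflect_flux_sub] at h1
    rw [link_succ, setIntegral_reflect, if_neg (Fin.succ_ne_zero i), neg_one_mul]
    have h3 : ∀ t, (φ ∘ reflectSpace) (t, -J.node i.succ) = φ (t, J.node i.succ) := fun t => by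
      simp [reflectSpace_apply]
    simp_rw [h3] at h1
    rw [← h1]
    refine integral_congr_ae (Eventually.of_forall fun p => ?_)
    simp only [reflectDensity, neg_neg, Diagram.reflect_flux, fderiv_reflect_time hφ,
      fderiv_reflect_space hφ, hu]
    ring
  · have htr' : ∀ᵐ t ∂(volume.restrict (Ioi 0)),
        Tendsto (reflectDensity F.rhoJam r t) (𝓝[<] (-J.node i.succ)) (𝓝 (F.rhoJam - z)) := by
      filter_upwards [htr] with t ht
      rw [side_succ] at ht
      exact tendsto_reflectDensity ht
    have h1 := (J.reflect_succ hr).eq_wave htr' (J.far_lt_neg_node i) hr0' hz' hs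
    have h2 := (measurePreserving_reflectSpace.restrict_preimage
      (measurableSet_Ioi.prod hIm.measurableSet)).quasiMeasurePreserving.ae h1
    rw [reflectSpace_preimage, ← link_succ] at h2
    have h3 := ae_restrict_of_ae_restrict_of_subset (J.determined_subset i.succ) h2
    filter_upwards [h3, ae_restrict_mem (J.measurableSet_determined i.succ)] with p h4 hp
    have h5 : ((p.2 + F.w * p.1 : ℝ) : EReal) < J.far i.succ := by
      simpa [Fin.succ_ne_zero] using hp.2.2
    have h6 := h4 (by
      have e : (-p.2 - F.w * p.1 : ℝ) = -(p.2 + F.w * p.1) := by ring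
      show -J.far i.succ < ((-p.2 - F.w * p.1 : ℝ) : EReal)
      rw [e, EReal.coe_neg, EReal.neg_lt_neg_iff]
      exact h5)
    simp only [reflectDensity, reflectSpace_apply, neg_neg] at h6
    simp only [Function.uncurry, reflectDensity]
    rw [hu, ← h6, sub_sub_cancel]

theorem exists_isLinkSolution {l : Fin (n + 1)} {r0 z : ℝ}
    (hr0 : r0 ∈ Icc 0 (J.diag l).rhoJam) (hz : z ∈ Icc 0 (J.diag l).rhoJam)
    (h : J.IsCompatible l r0 z) : ∃ v, J.IsLinkSolution l r0 z v := by
  induction l using Fin.cases with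
  | zero => exact J.exists_isLinkSolution_zero hr0 hz h
  | succ i => exact J.exists_isLinkSolution_succ hr0 hz h

theorem IsCompatible.eq_of_flux_eq {l : Fin (n + 1)} {r0 z z' : ℝ} (h : J.IsCompatible l r0 z)
    (h' : J.IsCompatible l r0 z') (he : (J.diag l).flux z = (J.diag l).flux z') : z = z' := by
  induction l using Fin.cases with
  | zero => exact (J.isCompatible_zero.1 h).eq_of_flux_eq (J.isCompatible_zero.1 h') he
  | succ i =>
    have := (J.isCompatible_succ.1 h).eq_of_flux_eq (J.isCompatible_succ.1 h')
      (by rw [Diagram.reflect_flux_sub, Diagram.reflect_flux_sub, he])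
    linarith

end Junction

/-! ### Pairs of flow and regime -/

section

variable {F : Diagram} {y z : State}

theorem density_mem (hy : IsState F y) : density F y ∈ Icc 0 F.rhoJam := by
  obtain ⟨-, h0, h1⟩ := density_spec F y hy
  have h2 := F.crit_mem
  rcases Fin.exists_fin_two.1 ⟨y.2, rfl⟩ with h | h
  · exact ⟨(h0 h).1, (h0 h).2.trans h2.2⟩
  · exact ⟨h2.1.trans (h1 h).1, (h1 h).2⟩

theorem flux_density (hy : IsState F y) : F.flux (density F y) = y.1 := (density_spec F y hy).1

/-- A density determines its flow and, below capacity, its regime. -/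
theorem state_eq_of_density_eq (hy : IsState F y) (hz : IsState F z)
    (h : density F z = density F y) : z.1 = y.1 ∧ (y.1 ≠ F.capacity → z.2 = y.2) := by
  refine ⟨by rw [← flux_density hz, h, flux_density hy], fun hne => ?_⟩
  obtain ⟨hy1, hy2, hy3⟩ := density_spec F y hy
  obtain ⟨hz1, hz2, hz3⟩ := density_spec F z hz
  by_contra hreg
  refine hne ?_
  rw [← hy1, ← Diagram.flux_crit]
  congr 1
  rcases Fin.exists_fin_two.1 ⟨y.2, rfl⟩ with h1 | h1 <;>
    rcases Fin.exists_fin_two.1 ⟨z.2, rfl⟩ with h2 | h2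
  · exact absurd (h2.trans h1.symm) hreg
  · exact le_antisymm (hy2 h1).2 (h ▸ (hz3 h2).1)
  · exact le_antisymm (h ▸ (hz2 h2).2) (hy3 h1).1
  · exact absurd (h2.trans h1.symm) hreg

/-- The flow of an admissible boundary state is at most the demand of the incoming link. -/
theorem IsAdmissibleTrace.flow_le (hy : IsState F y) (hz : IsState F z)
    (h : IsAdmissibleTrace F (density F y) (density F z)) :
    z.1 ≤ y.1 + (y.2 : ℕ) * (F.capacity - y.1) := by
  obtain ⟨hy1, hy2, -⟩ := density_spec F y hy
  rcases Fin.exists_fin_two.1 ⟨y.2, rfl⟩ with h1 | h1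
  · have := h.flux_le (hy2 h1).2
    rw [flux_density hy, flux_density hz] at this
    simpa [h1] using this
  · simpa [h1] using hz.2

/-- The regimes of the explicit formula lead to admissible boundary values. -/
theorem isAdmissibleTrace_of_regime (hy : IsState F y) (hz : IsState F z)
    (hq : z.1 ≤ y.1 + (y.2 : ℕ) * (F.capacity - y.1)) (h1 : y.2 = 1 → z.2 = 1)
    (h2 : y.2 = 0 → z.1 = y.1 → z.2 = 0) (h3 : y.2 = 0 → z.1 < y.1 → z.2 = 1) :
    IsAdmissibleTrace F (density F y) (density F z) := by
  obtain ⟨hy1, hy2, hy3⟩ := density_spec F y hy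
  obtain ⟨hz1, hz2, hz3⟩ := density_spec F z hz
  rcases Fin.exists_fin_two.1 ⟨y.2, rfl⟩ with hr | hr
  · have hle : z.1 ≤ y.1 := by simpa [hr] using hq
    rcases hle.eq_or_lt with he | hlt
    · left
      rw [show z = y from Prod.ext he ((h2 hr he).trans hr.symm)]
    · exact Or.inr ⟨(hz3 (h3 hr hlt)).1, Or.inr (by rwa [hz1, hy1])⟩
  · exact Or.inr ⟨(hz3 (h1 hr)).1, Or.inl (hy3 hr).1⟩

/-- The pair that denotes the density of the reflected link. -/
def reflectState (y : State) : State := (y.1, y.2.rev)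

theorem capacity_reflect : F.reflect.capacity = F.capacity := by
  simp only [Diagram.capacity, Diagram.reflect]
  ring

theorem isState_reflect (hy : IsState F y) : IsState F.reflect (reflectState y) := by
  rw [IsState, capacity_reflect]
  exact hy

theorem density_reflect (y : State) :
    density F.reflect (reflectState y) = F.rhoJam - density F y := by
  obtain ⟨q, r⟩ := y
  fin_cases r <;> simp [density, reflectState, Diagram.reflect]

end

/-! ### The junction -/

namespace Junction

variable {n : ℕ} {J : Junction n} {y₀ z : Fin (n + 1) → State}

theorem qmax_zero : J.qmax y₀ 0 =
    (y₀ 0).1 + ((y₀ 0).2 : ℕ) * ((J.diag 0).capacity - (y₀ 0).1) := by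
  simp [qmax]

theorem qmax_succ (i : Fin n) : J.qmax y₀ i.succ = (J.diag i.succ).capacity +
    ((y₀ i.succ).2 : ℕ) * ((y₀ i.succ).1 - (J.diag i.succ).capacity) := by
  simp [qmax]

theorem qmax_mem (hy₀ : ∀ l, IsState (J.diag l) (y₀ l)) (l : Fin (n + 1)) :
    J.qmax y₀ l ∈ Icc 0 (J.diag l).capacity := by
  have h := hy₀ l
  have hC : 0 ≤ (J.diag l).capacity := h.1.trans h.2
  rcases Fin.exists_fin_two.1 ⟨(y₀ l).2, rfl⟩ with hr | hr <;>
    unfold qmax <;> split_ifs <;> simp [hr]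
  · exact h
  · exact hC
  · exact hC
  · exact h

/-- The demand of a reflected outgoing link is its supply. -/
theorem qmax_succ_reflect (i : Fin n) : J.qmax y₀ i.succ =
    (reflectState (y₀ i.succ)).1 + ((reflectState (y₀ i.succ)).2 : ℕ) *
      ((J.diag i.succ).reflect.capacity - (reflectState (y₀ i.succ)).1) := by
  rw [qmax_succ, capacity_reflect]
  rcases Fin.exists_fin_two.1 ⟨(y₀ i.succ).2, rfl⟩ with hr | hr <;> simp [reflectState, hr]

theorem IsCompatible.flow_le (hy₀ : ∀ l, IsState (J.diag l) (y₀ l))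
    (hz : ∀ l, IsState (J.diag l) (z l)) {l : Fin (n + 1)}
    (h : J.IsCompatible l (density (J.diag l) (y₀ l)) (density (J.diag l) (z l))) :
    (z l).1 ≤ J.qmax y₀ l := by
  induction l using Fin.cases with
  | zero =>
    rw [qmax_zero]
    exact (J.isCompatible_zero.1 h).flow_le (hy₀ 0) (hz 0)
  | succ i =>
    have h' := J.isCompatible_succ.1 h
    rw [← density_reflect, ← density_reflect] at h'
    rw [qmax_succ_reflect]
    exact IsAdmissibleTrace.flow_le (z := reflectState (z i.succ)) (isState_reflect (hy₀ _))
      (isState_reflect (hz _)) h'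

/-- The flow at the junction is that of the boundary state; the one-sided limit in its definition
exists because the boundary value is attained. -/
theorem SolvesIBVP.flow_eq {ρ : Fin (n + 1) → ℝ → ℝ → ℝ} (h : J.SolvesIBVP y₀ z ρ)
    (hz : ∀ l, IsState (J.diag l) (z l)) (l : Fin (n + 1)) :
    ∀ᵐ t ∂(volume.restrict (Ioi 0)), J.flow l (ρ l) t = (z l).1 := by
  filter_upwards [h.boundary l] with t ht
  rw [flow, ht.limUnder_eq, flux_density (hz l)]

theorem SolvesIBVP.isCompatible {ρ : Fin (n + 1) → ℝ → ℝ → ℝ} (h : J.SolvesIBVP y₀ z ρ)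
    (hy₀ : ∀ l, IsState (J.diag l) (y₀ l)) (l : Fin (n + 1)) :
    J.IsCompatible l (density (J.diag l) (y₀ l)) (density (J.diag l) (z l)) :=
  J.isCompatible_of_trace (density_mem (hy₀ l)) (h.entropySolution l) (h.boundary l)

/-- An almost everywhere property of positive times that does not depend on the time. -/
theorem of_ae_time {p : Prop} (h : ∀ᵐ _t : ℝ ∂(volume.restrict (Ioi 0)), p) : p := by
  have : (ae (volume.restrict (Ioi (0 : ℝ)))).NeBot := by
    rw [ae_neBot, Ne, Measure.restrict_eq_zero, Real.volume_Ioi]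
    simp
  exact h.exists.choose_spec

/-- The flows of a distributed solution follow the turning ratios. -/
theorem SolvesIBVP.distribution {ρ : Fin (n + 1) → ℝ → ℝ → ℝ} (h : J.SolvesIBVP y₀ z ρ)
    (hz : ∀ l, IsState (J.diag l) (z l)) (hd : J.IsDistributedSolution ρ) (i : Fin n) :
    (z i.succ).1 = J.α i * (z 0).1 := by
  refine of_ae_time ?_
  filter_upwards [h.flow_eq hz 0, h.flow_eq hz i.succ, hd.distribution i] with t h1 h2 h3
  rw [← h1, ← h2, h3]

/-- The upper bounds on the flow into the junction: the demand of the incoming link, and the supply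
of each outgoing link that takes traffic, divided by its turning ratio. -/
def flowBounds (J : Junction n) (y₀ : Fin (n + 1) → State) : Set ℝ :=
  {J.qmax y₀ 0} ∪ {s | ∃ i : Fin n, J.α i ≠ 0 ∧ s = J.qmax y₀ i.succ / J.α i}

theorem exists_isLeast_flowBounds (J : Junction n) (y₀ : Fin (n + 1) → State) :
    ∃ q, IsLeast (J.flowBounds y₀) q := by
  have hfin : (J.flowBounds y₀).Finite := by
    refine (finite_singleton _).union
      ((finite_range fun i => J.qmax y₀ (Fin.succ i) / J.α i).subset ?_)
    rintro s ⟨i, -, rfl⟩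
    exact ⟨i, rfl⟩
  obtain ⟨q, hq, hmin⟩ := exists_min_image _ id hfin ⟨_, Or.inl rfl⟩
  exact ⟨q, hq, hmin⟩

/-- The flow of a distributed solution obeys all bounds. -/
theorem SolvesIBVP.flow_le {ρ : Fin (n + 1) → ℝ → ℝ → ℝ} (h : J.SolvesIBVP y₀ z ρ)
    (hy₀ : ∀ l, IsState (J.diag l) (y₀ l)) (hz : ∀ l, IsState (J.diag l) (z l))
    (hd : J.IsDistributedSolution ρ) {s : ℝ} (hs : s ∈ J.flowBounds y₀) : (z 0).1 ≤ s := by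
  have hle := fun l => IsCompatible.flow_le hy₀ hz (h.isCompatible hy₀ l)
  rcases hs with rfl | ⟨i, hi, rfl⟩
  · exact hle 0
  · have hpos : 0 < J.α i := lt_of_le_of_ne (J.α_nonneg i) (Ne.symm hi)
    rw [le_div_iff₀ hpos, mul_comm, ← h.distribution hz hd i]
    exact hle i.succ

/-- The boundary states for the flow `q` into the junction. If the flow at the junction is below the
initial one, then the incoming link turns from free flow to congestion, and an outgoing link from
congestion to free flow; in all other cases a link keeps its regime. -/
noncomputable def boundaryState (J : Junction n) (y₀ : Fin (n + 1) → State) (q : ℝ) :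
    Fin (n + 1) → State :=
  Fin.cases (q, if (y₀ 0).2 = 0 ∧ ¬q < (y₀ 0).1 then 0 else 1)
    fun i => (J.α i * q, if (y₀ i.succ).2 = 1 ∧ ¬J.α i * q < (y₀ i.succ).1 then 1 else 0)

section

variable {q : ℝ}

theorem boundaryState_zero_fst : (J.boundaryState y₀ q 0).1 = q := rfl

theorem boundaryState_succ_fst (i : Fin n) :
    (J.boundaryState y₀ q i.succ).1 = J.α i * q := rfl

theorem boundaryState_zero_snd : (J.boundaryState y₀ q 0).2 =
    if (y₀ 0).2 = 0 ∧ ¬q < (y₀ 0).1 then 0 else 1 := rfl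

theorem boundaryState_succ_snd (i : Fin n) : (J.boundaryState y₀ q i.succ).2 =
    if (y₀ i.succ).2 = 1 ∧ ¬J.α i * q < (y₀ i.succ).1 then 1 else 0 := rfl

theorem nonneg_of_isLeast (hy₀ : ∀ l, IsState (J.diag l) (y₀ l))
    (hq : IsLeast (J.flowBounds y₀) q) : 0 ≤ q := by
  rcases hq.1 with h | ⟨i, -, h⟩
  · rw [h]
    exact (qmax_mem hy₀ 0).1
  · rw [h]
    exact div_nonneg (qmax_mem hy₀ _).1 (J.α_nonneg i)

theorem boundaryState_le_qmax (hy₀ : ∀ l, IsState (J.diag l) (y₀ l))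
    (hq : IsLeast (J.flowBounds y₀) q) (l : Fin (n + 1)) :
    (J.boundaryState y₀ q l).1 ≤ J.qmax y₀ l := by
  induction l using Fin.cases with
  | zero => exact hq.2 (Or.inl rfl)
  | succ i =>
    rw [boundaryState_succ_fst]
    rcases eq_or_ne (J.α i) 0 with h | h
    · rw [h, zero_mul]
      exact (qmax_mem hy₀ _).1
    · have hpos : 0 < J.α i := lt_of_le_of_ne (J.α_nonneg i) (Ne.symm h)
      rw [mul_comm, ← le_div_iff₀ hpos]
      exact hq.2 (Or.inr ⟨i, h, rfl⟩)

theorem isState_boundaryState (hy₀ : ∀ l, IsState (J.diag l) (y₀ l))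
    (hq : IsLeast (J.flowBounds y₀) q) (l : Fin (n + 1)) :
    IsState (J.diag l) (J.boundaryState y₀ q l) := by
  refine ⟨?_, (boundaryState_le_qmax hy₀ hq l).trans (qmax_mem hy₀ l).2⟩
  have h0 := nonneg_of_isLeast hy₀ hq
  refine Fin.cases h0 (fun i => ?_) l
  exact mul_nonneg (J.α_nonneg i) h0

theorem isCompatible_boundaryState (hy₀ : ∀ l, IsState (J.diag l) (y₀ l))
    (hq : IsLeast (J.flowBounds y₀) q) (l : Fin (n + 1)) :
    J.IsCompatible l (density (J.diag l) (y₀ l))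
      (density (J.diag l) (J.boundaryState y₀ q l)) := by
  have hle := boundaryState_le_qmax hy₀ hq l
  have hst := isState_boundaryState hy₀ hq l
  induction l using Fin.cases with
  | zero =>
    rw [qmax_zero] at hle
    refine J.isCompatible_zero.2 (isAdmissibleTrace_of_regime (hy₀ 0) hst hle ?_ ?_ ?_) <;>
      simp only [boundaryState_zero_snd, boundaryState_zero_fst]
    · intro h; simp [h]
    · intro h h'; simp [h, h']
    · intro h h'; simp [h']
  | succ i =>
    rw [qmax_succ_reflect] at hle
    rw [isCompatible_succ, ← density_reflect, ← density_reflect]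
    refine isAdmissibleTrace_of_regime (isState_reflect (hy₀ _)) (isState_reflect hst) hle
      ?_ ?_ ?_ <;> simp only [reflectState, boundaryState_succ_snd, boundaryState_succ_fst]
    · intro h
      have h0 : (y₀ i.succ).2 = 0 := by
        rcases Fin.exists_fin_two.1 ⟨(y₀ i.succ).2, rfl⟩ with hr | hr
        · exact hr
        · simp [hr] at h
      simp [h0]
    · intro h h'
      have h1 : (y₀ i.succ).2 = 1 := by
        rcases Fin.exists_fin_two.1 ⟨(y₀ i.succ).2, rfl⟩ with hr | hr
        · simp [hr] at h
        · exact hr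
      simp [h1, h']
    · intro h h'
      simp [h']

end

/-- The waves on the links form a weak solution at the junction if the flows balance there. -/
theorem isWeakSolutionAt {r0 z : Fin (n + 1) → ℝ} {ρ : Fin (n + 1) → ℝ → ℝ → ℝ}
    (h : ∀ l, J.IsLinkSolution l (r0 l) (z l) (ρ l))
    (hflow : ∀ i : Fin n, (J.diag i.succ).flux (z i.succ) = J.α i * (J.diag 0).flux (z 0)) :
    J.IsWeakSolutionAt ρ := by
  intro φ hφ hφn
  have h1 : ∀ l, _ := fun l => (h l).balance (φ l) (hφ l).1 (hφ l).2.1 (hφ l).2.2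
  simp_rw [h1]
  rw [Fin.sum_univ_succ]
  simp only [if_true, one_mul, Fin.succ_ne_zero, if_false, hflow, ← (hφn _ _).1]
  rw [← Finset.sum_mul]
  simp_rw [neg_one_mul]
  rw [Finset.sum_neg_distrib, ← Finset.sum_mul, J.α_sum]
  ring

end Junction

end TrafficJunction

open TrafficJunction

theorem theorem1 (n : ℕ) (hn : 2 ≤ n) (J : Junction n) (y₀ : Fin (n + 1) → State)
    (hy₀ : ∀ l, IsState (J.diag l) (y₀ l)) :
    ∃ y : Fin (n + 1) → State,
      (∀ l, IsState (J.diag l) (y l)) ∧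
      -- the solution of the initial-boundary value problems with these boundary states exists,
      -- is unique, and is an admissible weak solution
      (∃ ρ : Fin (n + 1) → ℝ → ℝ → ℝ,
        J.SolvesIBVP y₀ y ρ ∧ J.IsAdmissible y₀ ρ ∧
        ∀ ρ' : Fin (n + 1) → ℝ → ℝ → ℝ, J.SolvesIBVP y₀ y ρ' →
          ∀ l, Function.uncurry (ρ' l) =ᵐ[volume.restrict (J.determined l)]
            Function.uncurry (ρ l)) ∧
      -- the boundary states are unique (both regimes denote the same density at capacity)
      (∀ z : Fin (n + 1) → State, (∀ l, IsState (J.diag l) (z l)) →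
        (∃ ρ : Fin (n + 1) → ℝ → ℝ → ℝ, J.SolvesIBVP y₀ z ρ ∧ J.IsAdmissible y₀ ρ) →
        ∀ l, (z l).1 = (y l).1 ∧ ((y l).1 ≠ (J.diag l).capacity → (z l).2 = (y l).2)) ∧
      -- the explicit formulas
      IsLeast ({J.qmax y₀ 0} ∪ {s | ∃ i : Fin n, J.α i ≠ 0 ∧ s = J.qmax y₀ i.succ / J.α i})
        (y 0).1 ∧
      ((y₀ 0).2 = 1 → (y 0).2 = 1) ∧
      ((y₀ 0).2 = 0 → (y 0).1 = (y₀ 0).1 → (y 0).2 = 0) ∧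
      ((y₀ 0).2 = 0 → (y 0).1 < (y₀ 0).1 → (y 0).2 = 1) ∧
      ∀ i : Fin n,
        (y i.succ).1 = J.α i * (y 0).1 ∧
        ((y₀ i.succ).2 = 0 → (y i.succ).2 = 0) ∧
        ((y₀ i.succ).2 = 1 → (y i.succ).1 = (y₀ i.succ).1 → (y i.succ).2 = 1) ∧
        ((y₀ i.succ).2 = 1 → (y i.succ).1 < (y₀ i.succ).1 → (y i.succ).2 = 0) := by
  obtain ⟨q, hq⟩ := J.exists_isLeast_flowBounds y₀
  set y := J.boundaryState y₀ q with hy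
  have hst : ∀ l, IsState (J.diag l) (y l) := Junction.isState_boundaryState hy₀ hq
  have hcomp := Junction.isCompatible_boundaryState hy₀ hq
  choose ρ hρ using fun l => J.exists_isLinkSolution (density_mem (hy₀ l)) (density_mem (hst l))
    (hcomp l)
  have hsolves : J.SolvesIBVP y₀ y ρ := ⟨fun l => (hρ l).entropySolution, fun l => by
    filter_upwards [ae_restrict_mem measurableSet_Ioi] with t ht
    exact (hρ l).trace t ht⟩
  have hflow := hsolves.flow_eq hst
  have hadm : J.IsAdmissible y₀ ρ := by
    refine ⟨⟨fun l t _ => (hρ l).boundedVariation t, Junction.isWeakSolutionAt hρ fun i => ?_,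
      fun i => ?_⟩, fun z ρ' hz hρ' hd => ?_⟩
    · rw [flux_density (hst _), flux_density (hst _)]
      rfl
    · filter_upwards [hflow 0, hflow i.succ] with t h0 h1
      rw [h0, h1]
      rfl
    · filter_upwards [hflow 0, hρ'.flow_eq hz 0] with t h0 h1
      rw [h0, h1]
      exact hρ'.flow_le hy₀ hz hd hq.1
  refine ⟨y, hst, ⟨ρ, hsolves, hadm, fun ρ' hρ' l => ?_⟩, fun z hz ⟨ρ', hρ', hadm'⟩ => ?_, hq,
    ?_, ?_, ?_, fun i => ⟨rfl, ?_, ?_, ?_⟩⟩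
  · exact (hρ l).unique (ρ' l) (hρ'.entropySolution l) (hρ'.boundary l)
  · -- maximality determines the flow, and compatibility the regime
    have h0 : (z 0).1 = (y 0).1 := by
      refine le_antisymm (hρ'.flow_le hy₀ hz hadm'.distributed hq.1) (Junction.of_ae_time ?_)
      filter_upwards [hadm'.maximal y ρ hst hsolves hadm.distributed, hflow 0,
        hρ'.flow_eq hz 0] with t h1 h2 h3
      rwa [h2, h3] at h1
    have hfl : ∀ l, (z l).1 = (y l).1 := by
      refine Fin.cases h0 fun i => ?_
      rw [hρ'.distribution hz hadm'.distributed i, h0]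
      rfl
    intro l
    refine state_eq_of_density_eq (hst l) (hz l)
      (Junction.IsCompatible.eq_of_flux_eq J (hρ'.isCompatible hy₀ l) (hcomp l) ?_)
    rw [flux_density (hz l), flux_density (hst l), hfl l]
  all_goals simp only [hy, Junction.boundaryState_zero_snd, Junction.boundaryState_zero_fst,
    Junction.boundaryState_succ_snd, Junction.boundaryState_succ_fst]
  · intro h; simp [h]
  · intro h h'; simp [h, h']
  · intro h h'; simp [h']
  · intro h; simp [h]
  · intro h h'; simp [h, h']
  · intro h h'; simp [h']
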